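/- Let $\{\epsilon_i\}_{i\in\mathbb Z}$ be i.i.d. random variables with mean zero and finite variance $\sigma^2$ ($\sigma\ge 0$), such that $\epsilon_1$ has zero median and a differentiable density function $f$ on $\mathbb R$ with $f(0)>0$ and $\sup_{x\in\mathbb R}|f'(x)|<\infty$. Let $(\rho_n)_{n\ge1}$ be real numbers and $(\kappa_n)_{n\ge1}$ nonnegative integers such that $\rho_n>1$ for all $n\ge 1$ and, as $n\to\infty$, $$n(\rho_n-1)\to0,\qquad \kappa_n/n\to\infty,\qquad \kappa_n(\rho_n-1)\to0 .$$ For each $n$ let the data $y_0,\dots,y_n$ (whose dependence on $n$ is suppressed) be given by $$y_0=\sum_{j=0}^{\kappa_n}\rho_n^j\epsilon_{-j},\qquad y_i=\rho_n y_{i-1}+\epsilon_i,\quad 1\le i\le n,$$ and let $\hat\rho_{\rm LAD}$ be any random variable which is almost surely a least absolute deviation estimator, that is, a minimiser over $\rho\in\mathbb R$ of $\frac1n\sum_{i=1}^n|y_i-\rho y_{i-1}|$ (the minimiser need not be unique). Then, as $n\to\infty$, $$\sqrt{n\kappa_n}\,(\hat\rho_{\rm LAD}-\rho_n)\to_d\frac{\mathcal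 C}{2\sigma f(0)} \qquad\text{and}\qquad \sqrt{\sum_{i=1}^n y_{i-1}^2}\,(\hat\rho_{\rm LAD}-\rho_n)\to_d\mathscr N\!\left(0,\frac1{4f(0)^2}\right),$$ where $\to_d$ denotes convergence in distribution, $\mathcal C$ is a standard Cauchy random variable and $\mathscr N(\mu,s^2)$ is the normal distribution with mean $\mu$ and variance $s^2$. -/

import Mathlib

open MeasureTheory ProbabilityTheory Filter Topology

/-- The trajectory of the AR(1) recursion `y_i = ρ y_{i-1} + ε_i` for `i ≥ 1`, started from
`y_0 = ∑_{j=0}^{κ} ρ^j ε_{-j}`, where `ε : ℤ → ℝ` is a realisation of the noise. -/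
def arPath (ρ : ℝ) (κ : ℕ) (ε : ℤ → ℝ) : ℕ → ℝ
  | 0 => ∑ j ∈ Finset.range (κ + 1), ρ ^ j * ε (-(j : ℤ))
  | i + 1 => ρ * arPath ρ κ ε i + ε ((i : ℤ) + 1)

/-- The least absolute deviation objective function
`r ↦ (1/n) ∑_{i=1}^n |y_i - r y_{i-1}|` for the data `y_0, …, y_n`. -/
noncomputable def ladObjective (n : ℕ) (y : ℕ → ℝ) (r : ℝ) : ℝ :=
  (1 / (n : ℝ)) * ∑ i ∈ Finset.Icc 1 n, |y i - r * y (i - 1)|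

/-- `r` is a least absolute deviation estimate for the data `y_0, …, y_n`: a global minimiser
over `ℝ` of the objective function (minimisers need not be unique). -/
def IsLADEstimate (n : ℕ) (y : ℕ → ℝ) (r : ℝ) : Prop :=
  IsMinOn (ladObjective n y) Set.univ r

/-! The initial value dominates the sample. Since `ρ ^ κ → 1`, `V = y 0 / √κ` is asymptotically `σ`
times a standard Gaussian. Since `ρ ^ n → 1` and `n / κ → 0`, the increments `y i - y 0`, `i ≤ n`,
are `o(√κ)` in quadratic mean. All regressors are therefore nearly equal: `y i / y 0 = 1 + e i` with
`e i` small.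

With `w = √n * y 0 * (r - ρ)`, the estimator minimises the convex function `w ↦ ∑ (|ε (i+1) - w (1 +
e i) / √n| - |ε (i+1)|)`. Its linear part is `-w S` up to a negligible martingale, where `S =
n^(-1/2) ∑ signPos (ε (i+1))`. Its remainder tends to `f 0 * w ^ 2`, because the density near `0` is
close to `f 0` (`tendsto_integral_abs_loss_sub`). Convexity turns pointwise closeness to a parabola
into closeness of the minimiser to the vertex (`tendstoInMeasure_argmin_sub`), so `W = √n * y 0 *
(ρLAD - ρ)` differs from `S / (2 f 0)` by `o_P(1)` (`tendstoInMeasure_lad_sub`).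

`S` involves the noise after time `0` and `V` the noise up to time `0`, so `(V, W)` converges
jointly to independent Gaussians. The first statistic is `W / V`, a ratio of independent Gaussians,
hence Cauchy (`map_div_gaussianReal_prod`). The second is asymptotically `|V| * W / V`, a Gaussian
times an independent sign, hence Gaussian (`map_sign_mul_gaussianReal_prod`). Division by `V` is
harmless because the limit of `V` has no atom at `0`. -/

/-! ### Tools for convergence in distribution. -/

section WeakConvergence

variable {Ω Ω' Ω'' E F : Type*} {mΩ : MeasurableSpace Ω} {mΩ' : MeasurableSpace Ω'}
  {mΩ'' : MeasurableSpace Ω''} {P : Measure Ω} [IsProbabilityMeasure P]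
  {P' : Measure Ω'} [IsProbabilityMeasure P'] {P'' : Measure Ω''} [IsProbabilityMeasure P'']
  [TopologicalSpace E] [MeasurableSpace E] [BorelSpace E]
  [TopologicalSpace F] [MeasurableSpace F] [BorelSpace F]

/-- Convergence in distribution only depends on the law of the limit. -/
theorem tendstoInDistribution_of_map_limit_eq {X : ℕ → Ω → E} {Z : Ω' → E} {Z' : Ω'' → E}
    (h : TendstoInDistribution X atTop Z (fun _ ↦ P) P') (hZ' : AEMeasurable Z' P'')
    (hmap : P'.map Z = P''.map Z') :
    TendstoInDistribution X atTop Z' (fun _ ↦ P) P'' where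
  forall_aemeasurable := h.forall_aemeasurable
  aemeasurable_limit := hZ'
  tendsto := by
    have := h.tendsto
    have heq : (⟨P'.map Z, Measure.isProbabilityMeasure_map h.aemeasurable_limit⟩ :
        ProbabilityMeasure E) = ⟨P''.map Z', Measure.isProbabilityMeasure_map hZ'⟩ :=
      Subtype.ext hmap
    rwa [heq] at this

theorem limsup_measure_preimage_closed_le [HasOuterApproxClosed E] {X : ℕ → Ω → E} {Z : Ω' → E}
    (h : TendstoInDistribution X atTop Z (fun _ ↦ P) P') {C : Set E} (hC : IsClosed C) :
    limsup (fun n ↦ P (X n ⁻¹' C)) atTop ≤ P' (Z ⁻¹' C) := by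
  have := ProbabilityMeasure.limsup_measure_closed_le_of_tendsto h.tendsto hC
  simp only [ProbabilityMeasure.coe_mk] at this
  rw [Measure.map_apply_of_aemeasurable h.aemeasurable_limit hC.measurableSet] at this
  refine le_trans (le_of_eq ?_) this
  congr 1
  ext n
  rw [Measure.map_apply_of_aemeasurable (h.forall_aemeasurable n) hC.measurableSet]

/-- **Continuous mapping theorem** for maps that are continuous at almost every point of the
limit. -/
theorem tendstoInDistribution_comp_of_ae_continuousAt [HasOuterApproxClosed E]
    {X : ℕ → Ω → E} {Z : Ω' → E}
    (h : TendstoInDistribution X atTop Z (fun _ ↦ P) P') {g : E → F} (hg : Measurable g)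
    (hcont : ∀ᵐ ω ∂P', ContinuousAt g (Z ω)) :
    TendstoInDistribution (fun n ω ↦ g (X n ω)) atTop (fun ω ↦ g (Z ω)) (fun _ ↦ P) P' where
  forall_aemeasurable n := hg.comp_aemeasurable (h.forall_aemeasurable n)
  aemeasurable_limit := hg.comp_aemeasurable h.aemeasurable_limit
  tendsto := by
    refine tendsto_of_forall_isClosed_limsup_le' fun C hC ↦ ?_
    simp only [ProbabilityMeasure.coe_mk]
    rw [Measure.map_apply_of_aemeasurable (f := fun ω ↦ g (Z ω))
      (hg.comp_aemeasurable h.aemeasurable_limit) hC.measurableSet]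
    -- A point of the closure at which `g` is continuous already lies in `g ⁻¹' C`, so taking the
    -- closure costs only a null set.
    have h1 : P' (Z ⁻¹' closure (g ⁻¹' C)) ≤ P' ((fun ω ↦ g (Z ω)) ⁻¹' C) := by
      refine measure_mono_ae ?_
      filter_upwards [hcont] with ω hω hmem
      change g (Z ω) ∈ C
      have := mem_closure_image hω hmem
      exact hC.closure_subset_iff.2 (Set.image_preimage_subset g C) this
    refine le_trans ?_ ((limsup_measure_preimage_closed_le h isClosed_closure).trans h1)
    refine limsup_le_limsup (Eventually.of_forall fun n ↦ ?_)
    change (P.map _) C ≤ _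
    rw [Measure.map_apply_of_aemeasurable (f := fun ω ↦ g (X n ω))
      (hg.comp_aemeasurable (h.forall_aemeasurable n)) hC.measurableSet]
    exact measure_mono fun ω hω ↦ subset_closure hω

/-- If `X n` converges in distribution to `Z`, which almost surely leaves a decreasing sequence of
closed sets, then `X n` is eventually unlikely to be in some member of the sequence. -/
theorem exists_eventually_measure_preimage_lt [HasOuterApproxClosed E]
    {X : ℕ → Ω → E} {Z : Ω' → E}
    (h : TendstoInDistribution X atTop Z (fun _ ↦ P) P') {C : ℕ → Set E} (hC : Antitone C)
    (hclosed : ∀ m, IsClosed (C m)) (hnull : ∀ᵐ ω ∂P', ∃ m, Z ω ∉ C m)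
    {τ : ENNReal} (hτ : 0 < τ) : ∃ m, ∀ᶠ n in atTop, P (X n ⁻¹' C m) < τ := by
  have h1 : Tendsto (fun m ↦ P' (Z ⁻¹' C m)) atTop (𝓝 (P' (⋂ m, Z ⁻¹' C m))) := by
    refine tendsto_measure_iInter_atTop (fun m ↦ ?_) (fun i j hij ↦ Set.preimage_mono (hC hij))
      ⟨0, measure_ne_top _ _⟩
    exact h.aemeasurable_limit.nullMeasurable (hclosed m).measurableSet
  have h0 : P' (⋂ m, Z ⁻¹' C m) = 0 := by
    refine measure_mono_null ?_ (ae_iff.1 hnull)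
    intro ω hω
    simpa using hω
  rw [h0] at h1
  obtain ⟨m, hm⟩ := (h1.eventually_lt_const hτ).exists
  exact ⟨m, eventually_lt_of_limsup_lt ((limsup_measure_preimage_closed_le h (hclosed m)).trans_lt hm)⟩

/-- Pairs of independent sequences that converge in distribution converge jointly. -/
theorem tendstoInDistribution_prodMk_of_indepFun [TopologicalSpace.PseudoMetrizableSpace E]
    [SecondCountableTopology E] [TopologicalSpace.PseudoMetrizableSpace F] [SecondCountableTopology F]
    {X : ℕ → Ω → E} {Y : ℕ → Ω → F} {Z : Ω' → E} {W : Ω'' → F}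
    (hX : TendstoInDistribution X atTop Z (fun _ ↦ P) P')
    (hY : TendstoInDistribution Y atTop W (fun _ ↦ P) P'')
    (hZ : Measurable Z) (hW : Measurable W) (hXY : ∀ n, IndepFun (X n) (Y n) P) :
    TendstoInDistribution (fun n ω ↦ (X n ω, Y n ω)) atTop (fun p : Ω' × Ω'' ↦ (Z p.1, W p.2))
      (fun _ ↦ P) (P'.prod P'') where
  forall_aemeasurable n := (hX.forall_aemeasurable n).prodMk (hY.forall_aemeasurable n)
  aemeasurable_limit := (hX.aemeasurable_limit.comp_fst).prodMk (hY.aemeasurable_limit.comp_snd)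
  tendsto := by
    have key := (ProbabilityMeasure.continuous_prod (α := E) (β := F)).continuousAt.tendsto.comp
      (hX.tendsto.prodMk_nhds hY.tendsto)
    have heq (n : ℕ) : (⟨P.map fun ω ↦ (X n ω, Y n ω), Measure.isProbabilityMeasure_map
        ((hX.forall_aemeasurable n).prodMk (hY.forall_aemeasurable n))⟩ :
        ProbabilityMeasure (E × F)) =
        ProbabilityMeasure.prod ⟨P.map (X n), Measure.isProbabilityMeasure_map
          (hX.forall_aemeasurable n)⟩ ⟨P.map (Y n), Measure.isProbabilityMeasure_map
          (hY.forall_aemeasurable n)⟩ :=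
      Subtype.ext ((indepFun_iff_map_prod_eq_prod_map_map (hX.forall_aemeasurable n)
        (hY.forall_aemeasurable n)).1 (hXY n))
    have heq' : (⟨(P'.prod P'').map fun p ↦ (Z p.1, W p.2), Measure.isProbabilityMeasure_map
        ((hX.aemeasurable_limit.comp_fst).prodMk (hY.aemeasurable_limit.comp_snd))⟩ :
        ProbabilityMeasure (E × F)) =
        ProbabilityMeasure.prod ⟨P'.map Z, Measure.isProbabilityMeasure_map hX.aemeasurable_limit⟩
          ⟨P''.map W, Measure.isProbabilityMeasure_map hY.aemeasurable_limit⟩ :=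
      Subtype.ext (Measure.map_prod_map _ _ hZ hW).symm
    simp_rw [heq, heq']
    exact key

end WeakConvergence

/-! ### The Cauchy and Gaussian limit laws. -/

section Laws

/-- This is the density at `c` of the ratio of two independent standard Gaussians. The two exponents
combine into `-(1 + c²) v² / 2`, and the even integrand reduces to an elementary integral over the
half line. -/
theorem lintegral_abs_mul_gaussianPDF_mul (c : ℝ) :
    ∫⁻ v, ENNReal.ofReal (gaussianPDFReal 0 1 v * (|v| * gaussianPDFReal 0 1 (v * c))) =
      cauchyPDF 0 1 c := by
  have hb : 0 < (1 + c ^ 2) / 2 := by positivity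
  have heq (v : ℝ) : gaussianPDFReal 0 1 v * (|v| * gaussianPDFReal 0 1 (v * c)) =
      (2 * Real.pi)⁻¹ * (|v| * Real.exp (-((1 + c ^ 2) / 2) * |v| ^ 2)) := by
    have h1 : (√(2 * Real.pi))⁻¹ * (√(2 * Real.pi))⁻¹ = (2 * Real.pi)⁻¹ := by
      rw [← mul_inv, Real.mul_self_sqrt (by positivity)]
    have h2 : Real.exp (-((1 + c ^ 2) / 2) * |v| ^ 2) =
        Real.exp (-v ^ 2 / 2) * Real.exp (-(v * c) ^ 2 / 2) := by
      rw [← Real.exp_add, sq_abs]; ring_nf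
    simp only [gaussianPDFReal, NNReal.coe_one, mul_one, sub_zero]
    rw [h2, ← h1]; ring
  have hint : Integrable (fun v : ℝ ↦ (2 * Real.pi)⁻¹ *
      (|v| * Real.exp (-((1 + c ^ 2) / 2) * |v| ^ 2))) := by
    refine Integrable.const_mul ?_ _
    have := (integrable_mul_exp_neg_mul_sq hb).norm
    refine this.congr (Eventually.of_forall fun v ↦ ?_)
    simp
  have hIoi : ∫ v in Set.Ioi (0 : ℝ), v * Real.exp (-((1 + c ^ 2) / 2) * v ^ 2) =
      (1 + c ^ 2)⁻¹ := by
    have h := integral_mul_cexp_neg_mul_sq (b := (((1 + c ^ 2) / 2 : ℝ) : ℂ)) 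
      (by rwa [Complex.ofReal_re])
    have h' : ((∫ v in Set.Ioi (0 : ℝ), v * Real.exp (-((1 + c ^ 2) / 2) * v ^ 2) : ℝ) : ℂ) =
        (((1 + c ^ 2)⁻¹ : ℝ) : ℂ) := by
      rw [← integral_complex_ofReal]
      refine Eq.trans ?_ (h.trans ?_)
      · congr 1; ext v; push_cast; ring_nf
      · push_cast; congr 1; ring
    exact_mod_cast h'
  simp_rw [heq]
  rw [← ofReal_integral_eq_lintegral_ofReal hint (Eventually.of_forall fun v ↦ by positivity),
    integral_const_mul,
    integral_comp_abs (f := fun v ↦ v * Real.exp (-((1 + c ^ 2) / 2) * v ^ 2)), hIoi, cauchyPDF_def,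
    cauchyPDFReal_def]
  congr 1
  simp only [NNReal.coe_one]
  field_simp
  ring

/-- The ratio of two independent standard Gaussian variables is standard Cauchy. -/
theorem map_div_gaussianReal_prod :
    ((gaussianReal 0 1).prod (gaussianReal 0 1)).map (fun p : ℝ × ℝ ↦ p.2 / p.1) =
      cauchyMeasure 0 1 := by
  have hdiv : Measurable fun p : ℝ × ℝ ↦ p.2 / p.1 := by fun_prop
  ext A hA
  -- For a fixed denominator `v` the ratio is Gaussian with density `|v| φ(v c)`; averaging over `v`
  -- and exchanging the integrals gives the Cauchy density.
  have hslice (v : ℝ) (hv : v ≠ 0) :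
      gaussianReal 0 1 (Prod.mk v ⁻¹' ((fun p : ℝ × ℝ ↦ p.2 / p.1) ⁻¹' A)) =
        ∫⁻ c in A, ENNReal.ofReal (|v| * gaussianPDFReal 0 1 (v * c)) := by
    have h1 : gaussianReal 0 1 (Prod.mk v ⁻¹' ((fun p : ℝ × ℝ ↦ p.2 / p.1) ⁻¹' A)) =
        ((gaussianReal 0 1).map (· / v)) A := by
      rw [Measure.map_apply (by fun_prop) hA]; rfl
    have hv2 : (1 : NNReal) / .mk (v ^ 2) (sq_nonneg v) ≠ 0 := by
      refine div_ne_zero one_ne_zero fun h ↦ ?_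
      exact pow_ne_zero 2 hv (congrArg NNReal.toReal h)
    have hvar : (1 : NNReal) / .mk (v ^ 2) (sq_nonneg v) =
        .mk (v ^ 2)⁻¹ (inv_nonneg.mpr (sq_nonneg _)) * 1 := by
      ext; simp
    rw [h1, gaussianReal_map_div_const, zero_div, gaussianReal_apply _ hv2]
    refine lintegral_congr fun c ↦ ?_
    rw [gaussianPDF_def, gaussianPDFReal_mul hv, ← mul_assoc, abs_inv,
      mul_inv_cancel₀ (abs_ne_zero.2 hv), one_mul, mul_zero, hvar]
  rw [Measure.map_apply hdiv hA, Measure.prod_apply (hdiv hA)]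
  have hae : ∀ᵐ v ∂(gaussianReal 0 1),
      gaussianReal 0 1 (Prod.mk v ⁻¹' ((fun p : ℝ × ℝ ↦ p.2 / p.1) ⁻¹' A)) =
        ∫⁻ c in A, ENNReal.ofReal (|v| * gaussianPDFReal 0 1 (v * c)) := by
    have := nullSingletonClass_gaussianReal (μ := 0) (one_ne_zero (α := NNReal))
    filter_upwards [compl_mem_ae_iff.2 (measure_singleton (0 : ℝ))] with v hv using hslice v hv
  have hm : Measurable fun p : ℝ × ℝ ↦
      ENNReal.ofReal (|p.1| * gaussianPDFReal 0 1 (p.1 * p.2)) := by fun_prop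
  rw [lintegral_congr_ae hae, gaussianReal_of_var_ne_zero 0 one_ne_zero,
    lintegral_withDensity_eq_lintegral_mul _ (by fun_prop) hm.lintegral_prod_right',
    cauchyMeasure_of_scale_ne_zero 0 one_ne_zero, withDensity_apply _ hA]
  simp only [Pi.mul_apply]
  simp_rw [← lintegral_const_mul' _ _ gaussianPDF_ne_top]
  rw [lintegral_lintegral_swap (by fun_prop)]
  refine lintegral_congr fun c ↦ ?_
  rw [← lintegral_abs_mul_gaussianPDF_mul]
  refine lintegral_congr fun v ↦ ?_
  rw [gaussianPDF_def, ENNReal.ofReal_mul (gaussianPDFReal_nonneg _ _ _)]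

/-- A centred Gaussian variable remains Gaussian when multiplied by an independent random sign. -/
theorem map_sign_mul_gaussianReal_prod (v : NNReal) :
    ((gaussianReal 0 1).prod (gaussianReal 0 v)).map (fun p : ℝ × ℝ ↦ |p.1| * p.2 / p.1) =
      gaussianReal 0 v := by
  have hmeas : Measurable fun p : ℝ × ℝ ↦ |p.1| * p.2 / p.1 := by fun_prop
  ext A hA
  rw [Measure.map_apply hmeas hA, Measure.prod_apply (hmeas hA)]
  have hae : ∀ᵐ x ∂(gaussianReal 0 1),
      gaussianReal 0 v (Prod.mk x ⁻¹' ((fun p : ℝ × ℝ ↦ |p.1| * p.2 / p.1) ⁻¹' A)) =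
        gaussianReal 0 v A := by
    have := nullSingletonClass_gaussianReal (μ := 0) (one_ne_zero (α := NNReal))
    filter_upwards [compl_mem_ae_iff.2 (measure_singleton (0 : ℝ))] with x hx
    have hx : x ≠ 0 := hx
    rcases hx.lt_or_gt with h | h
    · conv_rhs => rw [← neg_zero (G := ℝ), ← gaussianReal_map_neg, Measure.map_apply (by fun_prop) hA]
      congr 1
      ext w
      have : |x| * w / x = -w := by rw [abs_of_neg h]; field_simp
      simp [this]
    · congr 1
      ext w
      have : |x| * w / x = w := by rw [abs_of_pos h]; field_simp
      simp [this]
  rw [lintegral_congr_ae hae]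
  simp

end Laws

/-! ### Pointwise analysis of the absolute loss. -/

section AbsoluteLoss

/-- The sign of a real number, with the convention that `0` is negative. -/
noncomputable def signPos (x : ℝ) : ℝ := if 0 < x then 1 else -1

/-- The remainder in the first order expansion of `a ↦ |x - a|` at `0`. -/
noncomputable def absRem (a x : ℝ) : ℝ := |x - a| - |x| + a * signPos x

@[fun_prop]
theorem measurable_signPos : Measurable signPos :=
  Measurable.ite measurableSet_Ioi measurable_const measurable_const

theorem signPos_sq (x : ℝ) : signPos x ^ 2 = 1 := by
  unfold signPos; split_ifs <;> norm_num

theorem abs_signPos (x : ℝ) : |signPos x| = 1 := by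
  unfold signPos; split_ifs <;> norm_num

/-- `-signPos x` is a subgradient at `0` of the convex function `a ↦ |x - a|`. -/
theorem absRem_nonneg (a x : ℝ) : 0 ≤ absRem a x := by
  unfold absRem signPos
  split_ifs with h
  · rw [abs_of_pos h]; linarith [le_abs_self (x - a)]
  · rw [abs_of_nonpos (not_lt.1 h)]; linarith [neg_abs_le (x - a)]

theorem absRem_eq_zero {a x : ℝ} (h : |a| < |x|) : absRem a x = 0 := by
  unfold absRem signPos
  split_ifs with hx
  · rw [abs_of_pos hx] at h ⊢
    rw [abs_of_pos (by linarith [le_abs_self a])]; ring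
  · rw [abs_of_nonpos (not_lt.1 hx)] at h ⊢
    rw [abs_of_nonpos (by linarith [neg_abs_le a])]; ring

theorem abs_absRem_sub_le (a b x : ℝ) : |absRem a x - absRem b x| ≤ 2 * |a - b| := by
  have h : absRem a x - absRem b x = (|x - a| - |x - b|) + (a - b) * signPos x := by
    unfold absRem; ring
  have h1 : |(|x - a| - |x - b|)| ≤ |a - b| := by
    refine (abs_abs_sub_abs_le_abs_sub _ _).trans ?_
    rw [abs_sub_comm a b]; ring_nf; rfl
  rw [h]
  refine (abs_add_le _ _).trans ?_
  rw [abs_mul, abs_signPos]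
  linarith

/-- Both remainders vanish once `|x| > m`. The localisation gains a factor of order `m` in
expectation, which the Lipschitz bound alone would not give. -/
theorem abs_absRem_sub_le_indicator {a b m : ℝ} (ha : |a| ≤ m) (hb : |b| ≤ m) (x : ℝ) :
    |absRem a x - absRem b x| ≤ 2 * |a - b| * (Set.Icc (-m) m).indicator 1 x := by
  by_cases hx : |x| ≤ m
  · rw [Set.indicator_of_mem (show x ∈ Set.Icc (-m) m from abs_le.1 hx)]
    simpa using abs_absRem_sub_le a b x
  · rw [Set.indicator_of_notMem (show x ∉ Set.Icc (-m) m from fun h ↦ hx (abs_le.2 h))]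
    push Not at hx
    rw [absRem_eq_zero (ha.trans_lt hx), absRem_eq_zero (hb.trans_lt hx)]
    simp

theorem absRem_le_indicator (a x : ℝ) :
    absRem a x ≤ 2 * |a| * (Set.Icc (-|a|) |a|).indicator 1 x := by
  have h := abs_absRem_sub_le_indicator (le_refl |a|) (b := 0) (by simp) x
  have h0 : absRem 0 x = 0 := by simp [absRem]
  rw [h0, sub_zero, sub_zero, abs_of_nonneg (absRem_nonneg a x)] at h
  exact h

theorem integrable_absRem (a : ℝ) : Integrable (absRem a) := by
  have hb : Integrable fun x ↦ 2 * |a| * (Set.Icc (-|a|) |a|).indicator (1 : ℝ → ℝ) x := by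
    refine Integrable.const_mul ?_ _
    rw [integrable_indicator_iff measurableSet_Icc]
    exact integrableOn_const (by simp)
  refine hb.mono' (by unfold absRem; fun_prop) (Eventually.of_forall fun x ↦ ?_)
  rw [Real.norm_eq_abs, abs_of_nonneg (absRem_nonneg a x)]
  exact absRem_le_indicator a x

/-- The remainder is a triangular spike of base `|a|` and height `2 * |a|`. The area `a ^ 2` is why
the limiting parabola has leading coefficient exactly `f 0`. -/
theorem integral_absRem (a : ℝ) : ∫ x, absRem a x = a ^ 2 := by
  rcases le_or_gt 0 a with ha | ha
  · have h : absRem a = (Set.Ioc 0 a).indicator fun x ↦ 2 * (a - x) := by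
      ext x
      by_cases hx : x ∈ Set.Ioc 0 a
      · rw [Set.indicator_of_mem hx, absRem, signPos, if_pos hx.1, abs_of_pos hx.1,
          abs_of_nonpos (by linarith [hx.2])]; ring
      · rw [Set.indicator_of_notMem hx, absRem, signPos]
        split_ifs with h0
        · have : a < x := by by_contra h'; exact hx ⟨h0, not_lt.1 h'⟩
          rw [abs_of_pos h0, abs_of_pos (by linarith)]; ring
        · rw [abs_of_nonpos (not_lt.1 h0), abs_of_nonpos (by linarith)]; ring
    rw [h, integral_indicator measurableSet_Ioc, ← intervalIntegral.integral_of_le ha]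
    rw [intervalIntegral.integral_const_mul, intervalIntegral.integral_sub (by simp) (by simp),
      integral_id, intervalIntegral.integral_const]
    simp; ring
  · have h : absRem a = (Set.Ioc a 0).indicator fun x ↦ 2 * (x - a) := by
      ext x
      by_cases hx : x ∈ Set.Ioc a 0
      · rw [Set.indicator_of_mem hx, absRem, signPos, if_neg (not_lt.2 hx.2), abs_of_nonpos hx.2,
          abs_of_pos (by linarith [hx.1])]; ring
      · rw [Set.indicator_of_notMem hx, absRem, signPos]
        split_ifs with h0
        · rw [abs_of_pos h0, abs_of_pos (by linarith)]; ring
        · have : x ≤ a := by by_contra h'; exact hx ⟨not_le.1 h', not_lt.1 h0⟩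
          rw [abs_of_nonpos (not_lt.1 h0), abs_of_nonpos (by linarith)]; ring
    rw [h, integral_indicator measurableSet_Ioc, ← intervalIntegral.integral_of_le ha.le]
    rw [intervalIntegral.integral_const_mul, intervalIntegral.integral_sub (by simp) (by simp),
      integral_id, intervalIntegral.integral_const]
    simp; ring

/-- A minimiser of a convex function that is close to a parabola at three grid points is close to
the vertex of the parabola. -/
theorem abs_sub_lt_of_isMinOn_of_near_parabola {H : ℝ → ℝ} (hconv : ConvexOn ℝ Set.univ H)
    {w θ c b η τ : ℝ} (hmin : IsMinOn H Set.univ w) (hb : 0 < b) (hη : 0 < η)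
    (hτ : 2 * τ < 3 * b * η ^ 2) {g : ℝ} (hg : g ≤ θ) (hg' : θ < g + η)
    (h0 : |H g - (b * (g - θ) ^ 2 + c)| ≤ τ)
    (h1 : |H (g - 3 * η) - (b * (g - 3 * η - θ) ^ 2 + c)| ≤ τ)
    (h2 : |H (g + 3 * η) - (b * (g + 3 * η - θ) ^ 2 + c)| ≤ τ) : |w - θ| < 4 * η := by
  -- From `g` to `g ± 3η` the parabola rises by `b (9η² ∓ 6η (θ - g))`, which is at least `3bη² >
  -- 2τ` because `0 ≤ θ - g < η`. The errors cannot hide this rise, and convexity then confines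
  -- minimisers to between the two outer points.
  have hl : H g < H (g - 3 * η) := by
    have := (abs_le.1 h0).2
    have := (abs_le.1 h1).1
    nlinarith [mul_nonneg hb.le (mul_nonneg hη.le (sub_nonneg.2 hg)), mul_pos hb (pow_pos hη 2)]
  have hr : H g < H (g + 3 * η) := by
    have := (abs_le.1 h0).2
    have := (abs_le.1 h2).1
    nlinarith [mul_nonneg hb.le (mul_nonneg hη.le (sub_nonneg.2 hg'.le))]
  have hw : H w ≤ H g := hmin (Set.mem_univ g)
  have hwl : g - 3 * η < w := by
    by_contra! h
    have := hconv.le_max_of_mem_Icc (Set.mem_univ w) (Set.mem_univ g) (z := g - 3 * η)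
      ⟨h, by linarith⟩
    rw [max_eq_right hw] at this
    linarith
  have hwr : w < g + 3 * η := by
    by_contra! h
    have := hconv.le_max_of_mem_Icc (Set.mem_univ g) (Set.mem_univ w) (z := g + 3 * η)
      ⟨by linarith, h⟩
    rw [max_eq_left hw] at this
    linarith
  rw [abs_lt]
  constructor <;> linarith

theorem convexOn_sum_abs_sub_mul {ι : Type*} (s : Finset ι) (x z : ι → ℝ) :
    ConvexOn ℝ Set.univ fun w : ℝ ↦ ∑ i ∈ s, (|x i - w * z i| - |x i|) := by
  refine ⟨convex_univ, fun u _ v _ a b ha hb hab ↦ ?_⟩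
  simp only [smul_eq_mul]
  rw [Finset.mul_sum, Finset.mul_sum, ← Finset.sum_add_distrib]
  refine Finset.sum_le_sum fun i _ ↦ ?_
  have h : x i - (a * u + b * v) * z i = a * (x i - u * z i) + b * (x i - v * z i) := by
    linear_combination -(x i) * hab
  have h' := abs_add_le (a * (x i - u * z i)) (b * (x i - v * z i))
  rw [abs_mul, abs_mul, abs_of_nonneg ha, abs_of_nonneg hb] at h'
  rw [h]
  have : |x i| = a * |x i| + b * |x i| := by rw [← add_mul, hab, one_mul]
  linarith

end AbsoluteLoss

/-! ### Consequences of continuity of the density at zero. -/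

section Density

variable {f : ℝ → ℝ}

/-- A probability density that is continuous at `0` gives mass `O(t)` to `[-t, t]`. -/
theorem exists_withDensity_Icc_le (hf_cont : Continuous f)
    [IsProbabilityMeasure (volume.withDensity fun x ↦ ENNReal.ofReal (f x))] :
    ∃ C : ℝ, 0 < C ∧ ∀ t, 0 ≤ t →
      (volume.withDensity fun x ↦ ENNReal.ofReal (f x)) (Set.Icc (-t) t) ≤
        ENNReal.ofReal (C * t) := by
  obtain ⟨b, hb, hfb⟩ := Metric.continuousAt_iff.1 (hf_cont.continuousAt (x := 0)) 1 one_pos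
  have hM : 0 < |f 0| + 1 := by positivity
  -- The first entry serves `t < b`, where `f ≤ |f 0| + 1`; the second makes the bound at least `1`
  -- when `t ≥ b`.
  refine ⟨max (2 * (|f 0| + 1)) b⁻¹, by positivity, fun t ht ↦ ?_⟩
  rcases lt_or_ge t b with h | h
  · rw [withDensity_apply _ measurableSet_Icc]
    calc ∫⁻ x in Set.Icc (-t) t, ENNReal.ofReal (f x)
        ≤ ∫⁻ _ in Set.Icc (-t) t, ENNReal.ofReal (|f 0| + 1) := by
          refine setLIntegral_mono measurable_const fun x hx ↦ ENNReal.ofReal_le_ofReal ?_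
          have h1 : dist x 0 < b := by
            rw [Real.dist_0_eq_abs]; exact (abs_le.2 hx).trans_lt h
          have := hfb h1
          rw [Real.dist_eq] at this
          linarith [le_abs_self (f 0), le_abs_self (f x - f 0)]
      _ = ENNReal.ofReal (2 * (|f 0| + 1) * t) := by
          rw [setLIntegral_const, Real.volume_Icc, ← ENNReal.ofReal_mul hM.le]
          congr 1; ring
      _ ≤ _ := by gcongr; exact le_max_left _ _
  · refine prob_le_one.trans ?_
    rw [ENNReal.one_le_ofReal]
    calc 1 = b⁻¹ * b := (inv_mul_cancel₀ hb.ne').symm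
      _ ≤ _ := by gcongr; exact le_max_right _ _

/-- The expected remainder of the absolute loss is quadratic, with the density at `0` as
coefficient. -/
theorem exists_abs_integral_absRem_sub_le (hf_nonneg : ∀ x, 0 ≤ f x) (hf_cont : Continuous f)
    {η : ℝ} (hη : 0 < η) :
    ∃ b : ℝ, 0 < b ∧ ∀ a, |a| ≤ b →
      |∫ x, absRem a x ∂(volume.withDensity fun x ↦ ENNReal.ofReal (f x)) - f 0 * a ^ 2| ≤
        η * a ^ 2 := by
  obtain ⟨b, hb, hfb⟩ := Metric.continuousAt_iff.1 (hf_cont.continuousAt (x := 0)) η hη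
  -- The remainder is supported in `|x| ≤ |a| ≤ b / 2`, where `f` is within `η` of `f 0`.
  refine ⟨b / 2, by positivity, fun a ha ↦ ?_⟩
  rw [integral_withDensity_eq_integral_toReal_smul (by fun_prop) (by simp),
    ← integral_absRem a, ← integral_const_mul, ← integral_const_mul]
  simp_rw [ENNReal.toReal_ofReal (hf_nonneg _), smul_eq_mul]
  have hle (x : ℝ) : ‖f x * absRem a x - f 0 * absRem a x‖ ≤ η * absRem a x := by
    rw [← sub_mul, norm_mul, Real.norm_eq_abs, Real.norm_of_nonneg (absRem_nonneg a x)]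
    by_cases hx : |a| < |x|
    · simp [absRem_eq_zero hx]
    · have h1 : dist x 0 < b := by
        rw [Real.dist_0_eq_abs]; linarith
      exact mul_le_mul_of_nonneg_right (hfb h1).le (absRem_nonneg a x)
  have hint0 : Integrable fun x ↦ f 0 * absRem a x := (integrable_absRem a).const_mul _
  have hintd : Integrable fun x ↦ f x * absRem a x - f 0 * absRem a x :=
    ((integrable_absRem a).const_mul η).mono' (by unfold absRem; fun_prop)
      (Eventually.of_forall hle)
  have hint : Integrable fun x ↦ f x * absRem a x :=
    (hintd.add hint0).congr (Eventually.of_forall fun x ↦ by simp)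
  rw [← integral_sub hint hint0]
  exact norm_integral_le_of_norm_le ((integrable_absRem a).const_mul η) (Eventually.of_forall hle)

end Density

/-! ### Moment inequalities and small-ball estimates. -/

section Moments

variable {Ω : Type*} {mΩ : MeasurableSpace Ω} {P : Measure Ω}

/-- Nonnegativity of the variance of `|X|`. All later second-moment estimates become `L¹` bounds
through it. -/
theorem integral_abs_le_of_integral_sq_le [IsProbabilityMeasure P] {X : Ω → ℝ} (hX : MemLp X 2 P)
    {c : ℝ} (hc : 0 ≤ c) (h : ∫ ω, X ω ^ 2 ∂P ≤ c ^ 2) : ∫ ω, |X ω| ∂P ≤ c := by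
  have hX' : MemLp (fun ω ↦ |X ω|) 2 P := hX.norm
  have h1 := variance_nonneg (fun ω ↦ |X ω|) P
  rw [variance_eq_sub hX'] at h1
  simp only [Pi.pow_apply, sq_abs] at h1
  exact abs_le_of_sq_le_sq' (by linarith) hc |>.2

theorem integral_sum_sq_of_orthogonal {ι : Type*} (s : Finset ι) {X : ι → Ω → ℝ}
    (hX : ∀ i ∈ s, MemLp (X i) 2 P)
    (horth : ∀ i ∈ s, ∀ j ∈ s, i ≠ j → ∫ ω, X i ω * X j ω ∂P = 0) :
    ∫ ω, (∑ i ∈ s, X i ω) ^ 2 ∂P = ∑ i ∈ s, ∫ ω, X i ω ^ 2 ∂P := by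
  have hint : ∀ i ∈ s, ∀ j ∈ s, Integrable (fun ω ↦ X i ω * X j ω) P :=
    fun i hi j hj ↦ (hX i hi).integrable_mul (hX j hj)
  simp_rw [sq, Finset.sum_mul_sum]
  rw [integral_finsetSum _ fun i hi ↦ integrable_finsetSum _ fun j hj ↦ hint i hi j hj]
  refine Finset.sum_congr rfl fun i hi ↦ ?_
  rw [integral_finsetSum _ fun j hj ↦ hint i hi j hj]
  exact Finset.sum_eq_single_of_mem i hi fun j hj hij ↦ horth i hi j hj hij.symm

theorem tendstoInMeasure_zero_of_integral_abs_tendsto [IsFiniteMeasure P] {X : ℕ → Ω → ℝ}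
    (hX : ∀ n, Integrable (X n) P)
    (h : Tendsto (fun n ↦ ∫ ω, |X n ω| ∂P) atTop (𝓝 0)) : TendstoInMeasure P X atTop 0 := by
  rw [tendstoInMeasure_iff_measureReal_norm]
  intro δ hδ
  have h' : Tendsto (fun n ↦ (∫ ω, |X n ω| ∂P) / δ) atTop (𝓝 0) := by simpa using h.div_const δ
  refine squeeze_zero (fun n ↦ measureReal_nonneg) (fun n ↦ ?_) h'
  rw [le_div_iff₀ hδ, mul_comm]
  have := mul_meas_ge_le_integral_of_nonneg (Eventually.of_forall fun ω ↦ abs_nonneg (X n ω))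
    (hX n).abs δ
  simpa using this

/-- If `Y` is independent of `X` and puts mass at most `C t` on `[-t, t]`, then so it does for
random `t` that are functions of `X`. -/
theorem integral_mul_indicator_Icc_le_of_indepFun [IsProbabilityMeasure P] {X Y : Ω → ℝ}
    (hX : Measurable X) (hY : Measurable Y) (hXY : IndepFun X Y P) {C : ℝ}
    (hC : ∀ t, 0 ≤ t → P {ω | |Y ω| ≤ t} ≤ ENNReal.ofReal (C * t))
    {g m : ℝ → ℝ} (hg : Measurable g) (hm : Measurable m) (hg0 : ∀ x, 0 ≤ g x)
    (hm0 : ∀ x, 0 ≤ m x) (hC0 : 0 ≤ C) (hint : Integrable (fun ω ↦ g (X ω) * m (X ω)) P) :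
    ∫ ω, g (X ω) * (Set.Icc (-(m (X ω))) (m (X ω))).indicator 1 (Y ω) ∂P ≤
      C * ∫ ω, g (X ω) * m (X ω) ∂P := by
  have hset : MeasurableSet {p : ℝ × ℝ | |p.2| ≤ m p.1} :=
    measurableSet_le (by fun_prop) (by fun_prop)
  have hind (x y : ℝ) : (Set.Icc (-(m x)) (m x)).indicator (1 : ℝ → ℝ) y =
      {p : ℝ × ℝ | |p.2| ≤ m p.1}.indicator 1 (x, y) := by
    by_cases h : |y| ≤ m x
    · rw [Set.indicator_of_mem (show y ∈ Set.Icc (-(m x)) (m x) from abs_le.1 h),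
        Set.indicator_of_mem (show (x, y) ∈ {p : ℝ × ℝ | |p.2| ≤ m p.1} from h)]; rfl
    · rw [Set.indicator_of_notMem (show y ∉ Set.Icc (-(m x)) (m x) from fun h' ↦ h (abs_le.2 h')),
        Set.indicator_of_notMem (show (x, y) ∉ {p : ℝ × ℝ | |p.2| ≤ m p.1} from h)]
  simp_rw [hind]
  have hF : Measurable fun p : ℝ × ℝ ↦ {p : ℝ × ℝ | |p.2| ≤ m p.1}.indicator (1 : ℝ × ℝ → ℝ) p :=
    measurable_one.indicator hset
  have hF0 (p : ℝ × ℝ) : 0 ≤ {p : ℝ × ℝ | |p.2| ≤ m p.1}.indicator (1 : ℝ × ℝ → ℝ) p :=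
    Set.indicator_nonneg (fun _ _ ↦ zero_le_one) p
  have hrhs : 0 ≤ C * ∫ ω, g (X ω) * m (X ω) ∂P :=
    mul_nonneg hC0 (integral_nonneg fun ω ↦ mul_nonneg (hg0 _) (hm0 _))
  rw [integral_eq_lintegral_of_nonneg_ae
    (Eventually.of_forall fun ω ↦ mul_nonneg (hg0 _) (hF0 _))
    ((hg.comp hX).mul (hF.comp (hX.prodMk hY))).aestronglyMeasurable]
  refine ENNReal.toReal_le_of_le_ofReal hrhs ?_
  calc ∫⁻ ω, ENNReal.ofReal (g (X ω) * {p : ℝ × ℝ | |p.2| ≤ m p.1}.indicator 1 (X ω, Y ω)) ∂P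
      = ∫⁻ p, ENNReal.ofReal (g p.1 * {p : ℝ × ℝ | |p.2| ≤ m p.1}.indicator 1 p)
          ∂(P.map fun ω ↦ (X ω, Y ω)) := by
        rw [lintegral_map (by fun_prop) (hX.prodMk hY)]
    _ = ∫⁻ x, ∫⁻ y, ENNReal.ofReal (g x * {p : ℝ × ℝ | |p.2| ≤ m p.1}.indicator 1 (x, y))
          ∂(P.map Y) ∂(P.map X) := by
        have := Measure.isProbabilityMeasure_map (μ := P) hX.aemeasurable
        have := Measure.isProbabilityMeasure_map (μ := P) hY.aemeasurable
        rw [(indepFun_iff_map_prod_eq_prod_map_map hX.aemeasurable hY.aemeasurable).1 hXY,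
          lintegral_prod _ (by fun_prop)]
    _ ≤ ∫⁻ x, ENNReal.ofReal (C * (g x * m x)) ∂(P.map X) := by
        refine lintegral_mono fun x ↦ ?_
        have h1 (y : ℝ) : ENNReal.ofReal
            (g x * {p : ℝ × ℝ | |p.2| ≤ m p.1}.indicator (1 : ℝ × ℝ → ℝ) (x, y)) =
            ENNReal.ofReal (g x) * {y | |y| ≤ m x}.indicator 1 y := by
          rw [ENNReal.ofReal_mul (hg0 x)]
          congr 1
          by_cases h : |y| ≤ m x
          · rw [Set.indicator_of_mem (show y ∈ {y | |y| ≤ m x} from h),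
              Set.indicator_of_mem (show (x, y) ∈ {p : ℝ × ℝ | |p.2| ≤ m p.1} from h)]; simp
          · rw [Set.indicator_of_notMem (show y ∉ {y | |y| ≤ m x} from h),
              Set.indicator_of_notMem (show (x, y) ∉ {p : ℝ × ℝ | |p.2| ≤ m p.1} from h)]; simp
        have hs : MeasurableSet {y : ℝ | |y| ≤ m x} := measurableSet_le (by fun_prop) (by fun_prop)
        simp_rw [h1]
        rw [lintegral_const_mul' _ _ ENNReal.ofReal_ne_top, lintegral_indicator_one hs,
          Measure.map_apply hY hs]
        calc _ ≤ ENNReal.ofReal (g x) * ENNReal.ofReal (C * m x) := by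
              gcongr; exact hC _ (hm0 x)
          _ = _ := by rw [← ENNReal.ofReal_mul (hg0 x)]; congr 1; ring
    _ = ∫⁻ ω, ENNReal.ofReal (C * (g (X ω) * m (X ω))) ∂P := by
        rw [lintegral_map (by fun_prop) hX]
    _ = ENNReal.ofReal (C * ∫ ω, g (X ω) * m (X ω) ∂P) := by
        rw [← integral_const_mul, ofReal_integral_eq_lintegral_ofReal (hint.const_mul C)
          (Eventually.of_forall fun ω ↦ mul_nonneg hC0 (mul_nonneg (hg0 _) (hm0 _)))]

end Moments

/-! ### The filtration of the noise. -/

section Past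

variable {Ω : Type*} {mΩ : MeasurableSpace Ω} {P : Measure Ω} {ε : ℤ → Ω → ℝ}

/-- The σ-algebra generated by the noise up to time `i`. -/
@[reducible] def pastSigma (ε : ℤ → Ω → ℝ) (i : ℤ) : MeasurableSpace Ω :=
  ⨆ k ∈ Set.Iic i, MeasurableSpace.comap (ε k) inferInstance

theorem pastSigma_mono {i j : ℤ} (h : i ≤ j) : pastSigma ε i ≤ pastSigma ε j :=
  biSup_mono fun _ hk ↦ le_trans hk h

theorem pastSigma_le (hmeas : ∀ i, Measurable (ε i)) (i : ℤ) : pastSigma ε i ≤ mΩ :=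
  iSup₂_le fun k _ ↦ (hmeas k).comap_le

theorem measurable_pastSigma {k i : ℤ} (h : k ≤ i) : Measurable[pastSigma ε i] (ε k) :=
  (comap_measurable (ε k)).mono
    (le_iSup₂ (f := fun k (_ : k ∈ Set.Iic i) ↦ MeasurableSpace.comap (ε k) inferInstance) k h)
    le_rfl

theorem indepFun_of_measurable_pastSigma (hmeas : ∀ i, Measurable (ε i)) (hindep : iIndepFun ε P)
    {i j : ℤ} (hij : i < j) {X : Ω → ℝ} (hX : Measurable[pastSigma ε i] X) :
    IndepFun X (ε j) P := by
  have h := indep_iSup_of_disjoint (fun k ↦ (hmeas k).comap_le) hindep.iIndep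
    (S := Set.Iic i) (T := {j}) (by simpa using hij)
  rw [IndepFun_iff_Indep]
  refine indep_of_indep_of_le_left (indep_of_indep_of_le_right h ?_) hX.comap_le
  simp

end Past

/-! ### Quadratic approximation of the summed loss. -/

section CenteredLoss

variable {Ω : Type*} {mΩ : MeasurableSpace Ω} {P : Measure Ω} [IsProbabilityMeasure P]
  {ε : ℤ → Ω → ℝ}

theorem memLp_absRem {X : Ω → ℝ} (hX : Measurable X) (a : ℝ) :
    MemLp (fun ω ↦ absRem a (X ω)) 2 P := by
  refine MemLp.of_bound (C := 2 * |a|) (by unfold absRem; fun_prop)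
    (Eventually.of_forall fun ω ↦ ?_)
  have := abs_absRem_sub_le a 0 (X ω)
  simpa [absRem] using this

/-- One factor is bounded by its supremum `2 * |a|`. With a quadratic mean the second moment is
`O(|a|³)`, so a sum of `n` independent terms with `a = w / √n` has vanishing variance. -/
theorem integral_absRem_sq_le {X : Ω → ℝ} (hX : Measurable X) (a : ℝ) :
    ∫ ω, absRem a (X ω) ^ 2 ∂P ≤ 2 * |a| * ∫ ω, absRem a (X ω) ∂P := by
  rw [← integral_const_mul]
  refine integral_mono (memLp_absRem hX a).integrable_sq
    (((memLp_absRem hX a).integrable one_le_two).const_mul _) fun ω ↦ ?_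
  have h1 := absRem_nonneg a (X ω)
  have h2 : absRem a (X ω) ≤ 2 * |a| := by
    have := abs_absRem_sub_le a 0 (X ω)
    have h0 : absRem 0 (X ω) = 0 := by simp [absRem]
    rw [h0, sub_zero, sub_zero, abs_of_nonneg h1] at this
    exact this
  simp only [sq]
  exact mul_le_mul_of_nonneg_right h2 h1

theorem tendsto_div_sqrt_natCast (w : ℝ) : Tendsto (fun n : ℕ ↦ w / √(n : ℝ)) atTop (𝓝 0) :=
  (Real.tendsto_sqrt_atTop.comp tendsto_natCast_atTop_atTop).const_div_atTop w

/-- A weak law of large numbers: the `L¹` error is at most the standard deviation of the sum plus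
its bias, and both vanish. -/
theorem tendsto_integral_abs_sum_absRem_sub (hmeas : ∀ i, Measurable (ε i))
    (hindep : iIndepFun ε P) (hident : ∀ i, IdentDistrib (ε i) (ε 1) P P) {b : ℝ}
    (hquad : ∀ η > 0, ∃ c > 0, ∀ a, |a| ≤ c →
      |∫ ω, absRem a (ε 1 ω) ∂P - b * a ^ 2| ≤ η * a ^ 2) (w : ℝ) :
    Tendsto (fun n : ℕ ↦ ∫ ω, |∑ i ∈ Finset.range n, absRem (w / √n) (ε ((i : ℤ) + 1) ω) -
      b * w ^ 2| ∂P) atTop (𝓝 0) := by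
  set g : ℝ → ℝ := fun a ↦ ∫ ω, absRem a (ε 1 ω) ∂P
  set X : ℕ → Ω → ℝ := fun n ω ↦ ∑ i ∈ Finset.range n, absRem (w / √n) (ε ((i : ℤ) + 1) ω)
  have hXL2 (n : ℕ) : MemLp (X n) 2 P :=
    memLp_finsetSum _ fun i _ ↦ memLp_absRem (hmeas _) _
  have hid (a : ℝ) (i : ℤ) : IdentDistrib (fun ω ↦ absRem a (ε i ω)) (fun ω ↦ absRem a (ε 1 ω))
      P P := (hident i).comp (u := absRem a) (by unfold absRem; fun_prop)
  have hEX (n : ℕ) : ∫ ω, X n ω ∂P = n * g (w / √n) := by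
    simp only [X]
    rw [integral_finsetSum _ fun i _ ↦ (memLp_absRem (hmeas _) _).integrable one_le_two]
    simp [fun i ↦ (hid (w / √n) i).integral_eq, g]
  have hVar (n : ℕ) : variance (X n) P ≤ n * (2 * |w / √n| * g (w / √n)) := by
    have hsum : X n = ∑ i ∈ Finset.range n, fun ω ↦ absRem (w / √n) (ε ((i : ℤ) + 1) ω) := by
      ext ω; simp [X]
    rw [hsum, IndepFun.variance_sum (fun i _ ↦ memLp_absRem (hmeas _) _)]
    · calc _ ≤ ∑ i ∈ Finset.range n, 2 * |w / √n| * g (w / √n) := by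
            refine Finset.sum_le_sum fun i _ ↦ ?_
            rw [(hid _ _).variance_eq]
            refine le_trans ?_ (integral_absRem_sq_le (hmeas 1) _)
            exact variance_le_expectation_sq (memLp_absRem (hmeas _) _).1
        _ = _ := by simp
    · intro i _ j _ hij
      have hij' : (i : ℤ) + 1 ≠ j + 1 := by simpa using hij
      exact (hindep.indepFun hij').comp (φ := absRem (w / √n)) (ψ := absRem (w / √n))
        (by unfold absRem; fun_prop) (by unfold absRem; fun_prop)
  have hmean : Tendsto (fun n : ℕ ↦ n * g (w / √n)) atTop (𝓝 (b * w ^ 2)) := by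
    rw [Metric.tendsto_nhds]
    intro δ hδ
    -- The error is later multiplied by `n (w / √n)² = w²`; the `+ 1` keeps the result below `δ` and
    -- covers `w = 0`.
    obtain ⟨c, hc, hgc⟩ := hquad (δ / (w ^ 2 + 1)) (by positivity)
    have h1 : ∀ᶠ n : ℕ in atTop, |w / √n| < c := by
      have := (tendsto_div_sqrt_natCast w).abs
      rw [abs_zero] at this
      exact this.eventually_lt_const hc
    filter_upwards [h1, eventually_ge_atTop 1] with n hn hn1
    have hn0 : (0 : ℝ) < n := by exact_mod_cast hn1
    have hsq : n * (w / √n) ^ 2 = w ^ 2 := by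
      rw [div_pow, Real.sq_sqrt hn0.le]; field_simp
    have h2 := hgc _ hn.le
    rw [Real.dist_eq]
    calc |n * g (w / √n) - b * w ^ 2| = n * |g (w / √n) - b * (w / √n) ^ 2| := by
          rw [← abs_of_pos hn0, ← abs_mul, abs_of_pos hn0, ← hsq]; congr 1; ring
      _ ≤ n * (δ / (w ^ 2 + 1) * (w / √n) ^ 2) := by gcongr
      _ = δ * (w ^ 2 / (w ^ 2 + 1)) := by rw [mul_left_comm, hsq]; ring
      _ < δ * 1 := by
          gcongr
          rw [div_lt_one (by positivity)]; linarith
      _ = δ := mul_one δ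
  have hbound : Tendsto (fun n : ℕ ↦ √(n * (2 * |w / √n| * g (w / √n))) +
      |n * g (w / √n) - b * w ^ 2|) atTop (𝓝 0) := by
    have h1 : Tendsto (fun n : ℕ ↦ 2 * |w / √n| * (n * g (w / √n))) atTop
        (𝓝 (2 * |(0 : ℝ)| * (b * w ^ 2))) :=
      ((tendsto_div_sqrt_natCast w).abs.const_mul 2).mul hmean
    have h2 : Tendsto (fun n : ℕ ↦ √(n * (2 * |w / √n| * g (w / √n)))) atTop (𝓝 0) := by
      have := h1.sqrt
      simp only [abs_zero, mul_zero, zero_mul, Real.sqrt_zero] at this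
      refine this.congr fun n ↦ ?_
      congr 1; ring
    have h3 := (hmean.sub_const (b * w ^ 2)).abs
    rw [sub_self, abs_zero] at h3
    simpa using h2.add h3
  refine squeeze_zero (fun n ↦ integral_nonneg fun ω ↦ abs_nonneg _) (fun n ↦ ?_) hbound
  have hint : Integrable (X n) P := (hXL2 n).integrable one_le_two
  have hintd : Integrable (fun ω ↦ |X n ω - ∫ ω', X n ω' ∂P|) P :=
    (hint.sub (integrable_const _)).abs
  have hdev : ∫ ω, |X n ω - ∫ ω', X n ω' ∂P| ∂P ≤ √(n * (2 * |w / √n| * g (w / √n))) := by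
    have hL2' : MemLp (fun ω ↦ X n ω - ∫ ω', X n ω' ∂P) 2 P := (hXL2 n).sub (memLp_const _)
    refine integral_abs_le_of_integral_sq_le hL2' (Real.sqrt_nonneg _) ?_
    rw [Real.sq_sqrt ((variance_nonneg _ _).trans (hVar n)),
      ← variance_eq_integral (hXL2 n).1.aemeasurable]
    exact hVar n
  calc ∫ ω, |X n ω - b * w ^ 2| ∂P
      ≤ ∫ ω, (|X n ω - ∫ ω', X n ω' ∂P| + |∫ ω', X n ω' ∂P - b * w ^ 2|) ∂P := by
        refine integral_mono (hint.sub (integrable_const _)).abs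
          (hintd.add (integrable_const _)) fun ω ↦ ?_
        exact abs_sub_le _ _ _
    _ = ∫ ω, |X n ω - ∫ ω', X n ω' ∂P| ∂P + |∫ ω', X n ω' ∂P - b * w ^ 2| := by
        rw [integral_add hintd (integrable_const _)]
        simp
    _ ≤ _ := by
        rw [hEX] at hdev ⊢
        gcongr

/-- The difference is at most `2|a X|` and vanishes unless `|Y| ≤ |a| (1 + |X|)`, an event of
conditional probability at most `C |a| (1 + |X|)`. The resulting order `a² η` survives summation
over `n` terms with `a² = w² / n`. -/
theorem integral_abs_absRem_mul_sub_le {X Y : Ω → ℝ} (hX : Measurable X) (hY : Measurable Y)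
    (hXY : IndepFun X Y P) {C : ℝ} (hC0 : 0 ≤ C)
    (hC : ∀ t, 0 ≤ t → P {ω | |Y ω| ≤ t} ≤ ENNReal.ofReal (C * t)) (hL2 : MemLp X 2 P)
    {η : ℝ} (hη : 0 ≤ η) (hXη : ∫ ω, X ω ^ 2 ∂P ≤ η ^ 2) (a : ℝ) :
    ∫ ω, |absRem (a * (1 + X ω)) (Y ω) - absRem a (Y ω)| ∂P ≤
      C * (2 * a ^ 2 * (η + η ^ 2)) := by
  have hi1 : Integrable (fun ω ↦ |X ω|) P := (hL2.integrable one_le_two).abs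
  have hi2 : Integrable (fun ω ↦ X ω ^ 2) P := hL2.integrable_sq
  have hgm : (fun ω ↦ (2 * |a| * |X ω|) * (|a| * (1 + |X ω|))) =
      fun ω ↦ 2 * a ^ 2 * (|X ω| + X ω ^ 2) := by
    ext ω
    rw [← sq_abs a, ← sq_abs (X ω)]; ring
  have hint : Integrable (fun ω ↦ (2 * |a| * |X ω|) * (|a| * (1 + |X ω|))) P := by
    rw [hgm]; exact (hi1.add hi2).const_mul _
  have hmeasind : Measurable fun ω ↦
      (Set.Icc (-(|a| * (1 + |X ω|))) (|a| * (1 + |X ω|))).indicator (1 : ℝ → ℝ) (Y ω) := by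
    have : (fun ω ↦ (Set.Icc (-(|a| * (1 + |X ω|))) (|a| * (1 + |X ω|))).indicator
        (1 : ℝ → ℝ) (Y ω)) = {ω | |Y ω| ≤ |a| * (1 + |X ω|)}.indicator 1 := by
      ext ω
      simp only [Set.indicator, Set.mem_Icc, Set.mem_ofPred_eq, abs_le, Pi.one_apply]
    rw [this]
    exact measurable_one.indicator (measurableSet_le (by fun_prop) (by fun_prop))
  have hle (ω : Ω) : |absRem (a * (1 + X ω)) (Y ω) - absRem a (Y ω)| ≤
      (2 * |a| * |X ω|) *
        (Set.Icc (-(|a| * (1 + |X ω|))) (|a| * (1 + |X ω|))).indicator 1 (Y ω) := by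
    have h1 : |a * (1 + X ω)| ≤ |a| * (1 + |X ω|) := by
      rw [abs_mul]; gcongr
      exact (abs_add_le _ _).trans (by simp)
    have h2 : |a| ≤ |a| * (1 + |X ω|) := le_mul_of_one_le_right (abs_nonneg a) (by simp)
    have h3 := abs_absRem_sub_le_indicator h1 h2 (Y ω)
    have h4 : a * (1 + X ω) - a = a * X ω := by ring
    rwa [h4, abs_mul, ← mul_assoc] at h3
  have hbig : Integrable (fun ω ↦ (2 * |a| * |X ω|) *
      (Set.Icc (-(|a| * (1 + |X ω|))) (|a| * (1 + |X ω|))).indicator 1 (Y ω)) P := by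
    refine (hi1.const_mul (2 * |a|)).mono'
      (((measurable_const.mul hX.abs)).mul hmeasind).aestronglyMeasurable
      (Eventually.of_forall fun ω ↦ ?_)
    rw [norm_mul, Real.norm_of_nonneg (by positivity : 0 ≤ 2 * |a| * |X ω|)]
    refine mul_le_of_le_one_right (by positivity) ?_
    simp only [Set.indicator]; split_ifs <;> simp
  calc _ ≤ _ := integral_mono_of_nonneg (Eventually.of_forall fun ω ↦ abs_nonneg _) hbig
        (Eventually.of_forall hle)
    _ ≤ C * ∫ ω, (2 * |a| * |X ω|) * (|a| * (1 + |X ω|)) ∂P :=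
        integral_mul_indicator_Icc_le_of_indepFun hX hY hXY hC
          (g := fun x ↦ 2 * |a| * |x|) (m := fun x ↦ |a| * (1 + |x|)) (by fun_prop) (by fun_prop)
          (fun x ↦ by positivity) (fun x ↦ by positivity) hC0 hint
    _ ≤ _ := by
        rw [hgm, integral_const_mul, integral_add hi1 hi2]
        gcongr
        exact integral_abs_le_of_integral_sq_le hL2 hη hXη

-- The martingale difference property of the signs, obtained from independence and the zero median.
omit [IsProbabilityMeasure P] in
theorem integral_signPos_eq_zero_of_past (hmeas : ∀ i, Measurable (ε i)) (hindep : iIndepFun ε P)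
    (hident : ∀ i, IdentDistrib (ε i) (ε 1) P P) (hs : ∫ ω, signPos (ε 1 ω) ∂P = 0)
    {i j : ℤ} (hij : i < j) {X : Ω → ℝ} (hX : Measurable[pastSigma ε i] X) :
    ∫ ω, X ω * signPos (ε j ω) ∂P = 0 := by
  have h := (indepFun_of_measurable_pastSigma hmeas hindep hij hX).comp
    (φ := id) (ψ := signPos) measurable_id measurable_signPos
  have h0 : ∫ ω, signPos (ε j ω) ∂P = 0 := by
    rw [← hs]; exact ((hident j).comp measurable_signPos).integral_eq
  have := h.integral_fun_mul_eq_mul_integral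
    (hX.mono (pastSigma_le hmeas i) le_rfl).aestronglyMeasurable
    (measurable_signPos.comp (hmeas j)).aestronglyMeasurable
  simp only [Function.comp_apply, id_eq] at this
  rw [this, h0, mul_zero]

omit [IsProbabilityMeasure P] in
theorem memLp_mul_signPos {X Y : Ω → ℝ} (hX : MemLp X 2 P) (hY : Measurable Y) :
    MemLp (fun ω ↦ X ω * signPos (Y ω)) 2 P := by
  refine hX.mono (hX.1.mul (measurable_signPos.comp hY).aestronglyMeasurable)
    (Eventually.of_forall fun ω ↦ ?_)
  rw [norm_mul, Real.norm_eq_abs (signPos _), abs_signPos, mul_one]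

/-- Martingale differences are orthogonal, so the sum grows like `√n`, which the normalisation `w /
√n` absorbs. -/
theorem integral_abs_sum_mul_signPos_le (hmeas : ∀ i, Measurable (ε i)) (hindep : iIndepFun ε P)
    (hident : ∀ i, IdentDistrib (ε i) (ε 1) P P) (hs : ∫ ω, signPos (ε 1 ω) ∂P = 0)
    {n : ℕ} {e : ℕ → Ω → ℝ} (he : ∀ i : ℕ, i < n → Measurable[pastSigma ε i] (e i))
    (hL2 : ∀ i < n, MemLp (e i) 2 P) {η : ℝ} (hη : 0 ≤ η)
    (heη : ∀ i < n, ∫ ω, e i ω ^ 2 ∂P ≤ η ^ 2) :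
    ∫ ω, |∑ i ∈ Finset.range n, e i ω * signPos (ε ((i : ℤ) + 1) ω)| ∂P ≤ √n * η := by
  have hmem : ∀ i ∈ Finset.range n, MemLp (fun ω ↦ e i ω * signPos (ε ((i : ℤ) + 1) ω)) 2 P :=
    fun i hi ↦ memLp_mul_signPos (hL2 i (Finset.mem_range.1 hi)) (hmeas _)
  -- All factors except the later sign are measurable with respect to the past up to time `j`.
  have hlt {i j : ℕ} (hi : i < n) (hj : j < n) (hij : i < j) :
      ∫ ω, e i ω * signPos (ε ((i : ℤ) + 1) ω) * (e j ω * signPos (ε ((j : ℤ) + 1) ω)) ∂P = 0 := by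
    have h1 : Measurable[pastSigma ε j] fun ω ↦ e i ω * signPos (ε ((i : ℤ) + 1) ω) * e j ω :=
      ((((he i hi).mono (pastSigma_mono (by omega)) le_rfl)).mul
        (measurable_signPos.comp (measurable_pastSigma (by omega)))).mul (he j hj)
    rw [← integral_signPos_eq_zero_of_past hmeas hindep hident hs (by omega : (j : ℤ) < j + 1) h1]
    congr 1; ext ω; ring
  refine integral_abs_le_of_integral_sq_le (memLp_finsetSum _ hmem) (by positivity) ?_
  rw [integral_sum_sq_of_orthogonal _ hmem]
  · calc _ ≤ ∑ i ∈ Finset.range n, η ^ 2 := by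
          refine Finset.sum_le_sum fun i hi ↦ ?_
          simp_rw [mul_pow, signPos_sq, mul_one]
          exact heη i (Finset.mem_range.1 hi)
      _ = _ := by rw [mul_pow, Real.sq_sqrt (Nat.cast_nonneg n)]; simp
  · intro i hi j hj hij
    rw [Finset.mem_range] at hi hj
    rcases hij.lt_or_gt with h | h
    · exact hlt hi hj h
    · rw [← hlt hj hi h]; congr 1; ext ω; ring

/-- Quadratic approximation of the centred absolute loss with regressors close to `1`. -/
theorem tendsto_integral_abs_loss_sub (hmeas : ∀ i, Measurable (ε i))
    (hindep : iIndepFun ε P) (hident : ∀ i, IdentDistrib (ε i) (ε 1) P P)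
    (hs : ∫ ω, signPos (ε 1 ω) ∂P = 0) {C : ℝ} (hC0 : 0 ≤ C)
    (hC : ∀ t, 0 ≤ t → P {ω | |ε 1 ω| ≤ t} ≤ ENNReal.ofReal (C * t)) {b : ℝ}
    (hquad : ∀ η > 0, ∃ c > 0, ∀ a, |a| ≤ c →
      |∫ ω, absRem a (ε 1 ω) ∂P - b * a ^ 2| ≤ η * a ^ 2)
    {e : ℕ → ℕ → Ω → ℝ} (he : ∀ n i : ℕ, i < n → Measurable[pastSigma ε i] (e n i))
    (hL2 : ∀ n, ∀ i < n, MemLp (e n i) 2 P) {η : ℕ → ℝ} (hη : ∀ n, 0 ≤ η n)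
    (heη : ∀ n, ∀ i < n, ∫ ω, e n i ω ^ 2 ∂P ≤ η n ^ 2) (hη0 : Tendsto η atTop (𝓝 0)) (w : ℝ) :
    (∀ n : ℕ, Integrable (fun ω ↦ ∑ i ∈ Finset.range n,
        (|ε ((i : ℤ) + 1) ω - w * ((1 + e n i ω) / √n)| - |ε ((i : ℤ) + 1) ω|) -
        (b * w ^ 2 - w * ((√n)⁻¹ * ∑ i ∈ Finset.range n, signPos (ε ((i : ℤ) + 1) ω)))) P) ∧
    Tendsto (fun n : ℕ ↦ ∫ ω, |∑ i ∈ Finset.range n,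
        (|ε ((i : ℤ) + 1) ω - w * ((1 + e n i ω) / √n)| - |ε ((i : ℤ) + 1) ω|) -
        (b * w ^ 2 - w * ((√n)⁻¹ * ∑ i ∈ Finset.range n, signPos (ε ((i : ℤ) + 1) ω)))| ∂P)
      atTop (𝓝 0) := by
  have hem (n i : ℕ) (hi : i < n) : Measurable (e n i) :=
    (he n i hi).mono (pastSigma_le hmeas _) le_rfl
  set A : ℕ → Ω → ℝ := fun n ω ↦
    ∑ i ∈ Finset.range n, absRem (w / √n) (ε ((i : ℤ) + 1) ω) - b * w ^ 2
  set B : ℕ → ℕ → Ω → ℝ := fun n i ω ↦ absRem (w / √n * (1 + e n i ω)) (ε ((i : ℤ) + 1) ω) -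
    absRem (w / √n) (ε ((i : ℤ) + 1) ω)
  set D : ℕ → Ω → ℝ := fun n ω ↦ ∑ i ∈ Finset.range n, e n i ω * signPos (ε ((i : ℤ) + 1) ω)
  have hAi (n : ℕ) : Integrable (A n) P :=
    (integrable_finsetSum _ fun i _ ↦ (memLp_absRem (hmeas _) _).integrable one_le_two).sub
      (integrable_const _)
  have hBi (n i : ℕ) (hi : i < n) : Integrable (B n i) P := by
    have := hem n i hi
    have := hmeas (i + 1)
    refine ((((hL2 n i hi).integrable one_le_two).abs).const_mul (2 * |w / √n|)).mono'
      (by unfold B absRem; fun_prop) (Eventually.of_forall fun ω ↦ ?_)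
    refine (abs_absRem_sub_le _ _ _).trans (le_of_eq ?_)
    rw [mul_assoc, ← abs_mul]; ring_nf
  have hDi (n : ℕ) : Integrable (D n) P := integrable_finsetSum _ fun i hi ↦
    (memLp_mul_signPos (hL2 n i (Finset.mem_range.1 hi)) (hmeas _)).integrable one_le_two
  have hBs (n : ℕ) : Integrable (fun ω ↦ ∑ i ∈ Finset.range n, B n i ω) P :=
    integrable_finsetSum _ fun i hi ↦ hBi n i (Finset.mem_range.1 hi)
  -- `A` is the error when all regressors equal `1`, `B` the change in the remainders caused by `e`,
  -- and `D` the martingale that `e` adds to the linear term.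
  have hdecomp (n : ℕ) (ω : Ω) : ∑ i ∈ Finset.range n,
        (|ε ((i : ℤ) + 1) ω - w * ((1 + e n i ω) / √n)| - |ε ((i : ℤ) + 1) ω|) -
        (b * w ^ 2 - w * ((√n)⁻¹ * ∑ i ∈ Finset.range n, signPos (ε ((i : ℤ) + 1) ω))) =
      A n ω + ∑ i ∈ Finset.range n, B n i ω - w / √n * D n ω := by
    have h1 (i : ℕ) : |ε ((i : ℤ) + 1) ω - w * ((1 + e n i ω) / √n)| - |ε ((i : ℤ) + 1) ω| =
        absRem (w / √n) (ε ((i : ℤ) + 1) ω) + B n i ω -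
        w / √n * (e n i ω * signPos (ε ((i : ℤ) + 1) ω)) -
        w * ((√n)⁻¹ * signPos (ε ((i : ℤ) + 1) ω)) := by
      have h2 : w * ((1 + e n i ω) / √n) = w / √n * (1 + e n i ω) := by ring
      simp only [B, h2]
      simp only [absRem]
      ring
    simp_rw [h1]
    simp only [A, D, Finset.sum_sub_distrib, Finset.sum_add_distrib, Finset.mul_sum]
    ring
  have hfull (n : ℕ) : Integrable
      (fun ω ↦ A n ω + ∑ i ∈ Finset.range n, B n i ω - w / √n * D n ω) P :=
    ((hAi n).add (hBs n)).sub ((hDi n).const_mul _)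
  refine ⟨fun n ↦ by simp_rw [hdecomp]; exact hfull n, ?_⟩
  have hbound : Tendsto (fun n : ℕ ↦ ∫ ω, |A n ω| ∂P + C * (2 * w ^ 2 * (η n + η n ^ 2)) +
      |w| * η n) atTop (𝓝 0) := by
    have h1 := tendsto_integral_abs_sum_absRem_sub hmeas hindep hident hquad w
    have h2 := ((hη0.add (hη0.pow 2)).const_mul (2 * w ^ 2)).const_mul C
    have h3 := hη0.const_mul |w|
    simpa using (h1.add h2).add h3
  refine squeeze_zero' (Eventually.of_forall fun n ↦ integral_nonneg fun ω ↦ abs_nonneg _) ?_ hbound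
  filter_upwards [eventually_ge_atTop 1] with n hn
  have hn0 : (0 : ℝ) < n := by exact_mod_cast hn
  have hBle : ∫ ω, |∑ i ∈ Finset.range n, B n i ω| ∂P ≤ C * (2 * w ^ 2 * (η n + η n ^ 2)) := by
    have hsum : Integrable (fun ω ↦ ∑ i ∈ Finset.range n, |B n i ω|) P :=
      integrable_finsetSum _ fun i hi ↦ (hBi n i (Finset.mem_range.1 hi)).abs
    calc ∫ ω, |∑ i ∈ Finset.range n, B n i ω| ∂P
        ≤ ∫ ω, ∑ i ∈ Finset.range n, |B n i ω| ∂P :=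
          integral_mono (hBs n).abs hsum fun ω ↦ Finset.abs_sum_le_sum_abs _ _
      _ = ∑ i ∈ Finset.range n, ∫ ω, |B n i ω| ∂P :=
          integral_finsetSum _ fun i hi ↦ (hBi n i (Finset.mem_range.1 hi)).abs
      _ ≤ ∑ i ∈ Finset.range n, C * (2 * (w / √n) ^ 2 * (η n + η n ^ 2)) := by
          refine Finset.sum_le_sum fun i hi ↦ ?_
          have hi := Finset.mem_range.1 hi
          refine integral_abs_absRem_mul_sub_le (hem n i hi) (hmeas _)
            (indepFun_of_measurable_pastSigma hmeas hindep (by omega) (he n i hi)) hC0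
            (fun t ht ↦ ?_) (hL2 n i hi) (hη n) (heη n i hi) _
          refine le_trans (le_of_eq ?_) (hC t ht)
          exact (hident _).measure_mem_eq (s := {x | |x| ≤ t})
            (measurableSet_le (by fun_prop) (by fun_prop))
      _ = _ := by
          rw [Finset.sum_const, Finset.card_range, nsmul_eq_mul, div_pow, Real.sq_sqrt hn0.le]
          field_simp
  have hDle := integral_abs_sum_mul_signPos_le hmeas hindep hident hs (he n) (hL2 n) (hη n) (heη n)
  have hDle' : |w / √n| * ∫ ω, |D n ω| ∂P ≤ |w| * η n := by
    calc _ ≤ |w / √n| * (√n * η n) := by gcongr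
      _ = _ := by
        rw [abs_div, abs_of_pos (Real.sqrt_pos.2 hn0)]
        field_simp
  simp_rw [hdecomp]
  calc ∫ ω, |A n ω + ∑ i ∈ Finset.range n, B n i ω - w / √n * D n ω| ∂P
      ≤ ∫ ω, (|A n ω| + |∑ i ∈ Finset.range n, B n i ω| + |w / √n| * |D n ω|) ∂P := by
        refine integral_mono (hfull n).abs
          (((hAi n).abs.add (hBs n).abs).add ((hDi n).abs.const_mul _)) fun ω ↦ ?_
        refine (abs_sub _ _).trans ?_
        simp only
        rw [abs_mul]
        gcongr
        exact abs_add_le _ _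
    _ = ∫ ω, |A n ω| ∂P + ∫ ω, |∑ i ∈ Finset.range n, B n i ω| ∂P +
          |w / √n| * ∫ ω, |D n ω| ∂P := by
        have hAB : Integrable (fun ω ↦ |A n ω| + |∑ i ∈ Finset.range n, B n i ω|) P :=
          (hAi n).abs.add (hBs n).abs
        rw [integral_add hAB ((hDi n).abs.const_mul _),
          integral_add (hAi n).abs (hBs n).abs, integral_const_mul]
    _ ≤ _ := by gcongr

end CenteredLoss

/-! ### Convergence of minimisers and of perturbed sequences. -/

section Argmin

variable {Ω : Type*} {mΩ : MeasurableSpace Ω} {P : Measure Ω}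

/-- Minimisers of convex random functions that converge pointwise in measure to parabolas with
tight vertices are close to these vertices. -/
theorem tendstoInMeasure_argmin_sub {W θ : ℕ → Ω → ℝ} {b : ℝ} (hb : 0 < b)
    (hθ : ∀ τ : ENNReal, 0 < τ → ∃ K : ℝ, ∀ᶠ n in atTop, P {ω | K ≤ |θ n ω|} < τ)
    (hH : ∀ τ : ENNReal, 0 < τ → ∃ (H : ℕ → Ω → ℝ → ℝ) (bad : ℕ → Set Ω),
      (∀ᶠ n in atTop, P (bad n) < τ) ∧
      (∀ n ω, ConvexOn ℝ Set.univ (H n ω)) ∧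
      (∀ᶠ n in atTop, ∀ᵐ ω ∂P, ω ∉ bad n → IsMinOn (H n ω) Set.univ (W n ω)) ∧
      ∀ w, TendstoInMeasure P
        (fun n ω ↦ H n ω w - (b * w ^ 2 - w * (2 * b * θ n ω))) atTop 0) :
    TendstoInMeasure P (fun n ω ↦ W n ω - θ n ω) atTop 0 := by
  rw [tendstoInMeasure_iff_norm]
  intro δ hδ
  rw [ENNReal.tendsto_nhds_zero]
  intro τ hτ
  have hτ3 : 0 < τ / 3 := ENNReal.div_pos hτ.ne' (by simp)
  obtain ⟨K, hK⟩ := hθ _ hτ3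
  obtain ⟨H, bad, hbad, hconv, hmin, hlim⟩ := hH _ hτ3
  -- The deterministic estimate locates the minimiser within `4η`, and it tolerates errors `t = b
  -- η²` since `2t < 3bη²`.
  set η := δ / 4 with hη_def
  have hη : 0 < η := by positivity
  set t := b * η ^ 2 with ht_def
  have ht : 0 < t := by positivity
  -- A finite grid suffices because the vertex is tight. The margin is `3` for the neighbours `k ±
  -- 3` and `1` for rounding.
  set N : ℤ := ⌈K / η⌉ + 4 with hN
  set G : Finset ℤ := Finset.Icc (-N) N
  set X : ℤ → ℕ → Ω → ℝ := fun k n ω ↦ H n ω (k * η) -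
    (b * (k * η) ^ 2 - (k * η) * (2 * b * θ n ω)) with hX
  have hgrid : ∀ᶠ n in atTop, ∑ k ∈ G, P {ω | t ≤ |X k n ω|} < τ / 3 := by
    have h1 : Tendsto (fun n ↦ ∑ k ∈ G, P {ω | t ≤ |X k n ω|}) atTop (𝓝 (∑ k ∈ G, 0)) := by
      refine tendsto_finsetSum _ fun k _ ↦ ?_
      have := (tendstoInMeasure_iff_norm.1 (hlim (k * η))) t ht
      simpa using this
    rw [Finset.sum_const_zero] at h1
    exact h1.eventually_lt_const hτ3
  filter_upwards [hK, hbad, hmin, hgrid] with n hKn hbadn hminn hgridn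
  have hsub : ∀ᵐ ω ∂P, ω ∈ {ω | δ ≤ ‖W n ω - θ n ω - (0 : Ω → ℝ) ω‖} →
      ω ∈ {ω | K ≤ |θ n ω|} ∪ bad n ∪ ⋃ k ∈ G, {ω | t ≤ |X k n ω|} := by
    filter_upwards [hminn] with ω hω hmem
    by_contra hnot
    simp only [Set.mem_union, Set.mem_iUnion, not_or, not_exists] at hnot
    obtain ⟨⟨h1, h2⟩, h3⟩ := hnot
    have h1 : |θ n ω| < K := not_le.1 h1
    have h3 : ∀ k ∈ G, |X k n ω| < t := fun k hk ↦ not_le.1 (h3 k hk)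
    set k : ℤ := ⌊θ n ω / η⌋ with hk
    have hk1 : (k : ℝ) ≤ θ n ω / η := Int.floor_le _
    have hk2 : θ n ω / η < k + 1 := Int.lt_floor_add_one _
    have hθK : |θ n ω / η| < K / η := by
      rw [abs_div, abs_of_pos hη]; gcongr
    have hceil : K / η ≤ ⌈K / η⌉ := Int.le_ceil _
    have hkN : -(N - 3) ≤ k ∧ k ≤ N - 3 := by
      have := abs_lt.1 hθK
      constructor
      · have : (-(⌈K / η⌉ + 1) : ℝ) ≤ k := by linarith
        have : -(⌈K / η⌉ + 1) ≤ k := by exact_mod_cast this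
        omega
      · have : (k : ℝ) ≤ ⌈K / η⌉ := by linarith
        have : k ≤ ⌈K / η⌉ := by exact_mod_cast this
        omega
    -- Completing the square puts the parabola in vertex form with minimum `-b θ²`.
    have hval (j : ℤ) (hj : j ∈ G) (g : ℝ) (hg : g = j * η) :
        |H n ω g - (b * (g - θ n ω) ^ 2 + -(b * θ n ω ^ 2))| ≤ t := by
      have := (h3 j hj).le
      rw [hg]
      refine le_trans (le_of_eq ?_) this
      simp only [hX]
      congr 1; ring
    have hlt := abs_sub_lt_of_isMinOn_of_near_parabola (hconv n ω) (hω h2) hb hη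
      (τ := t) (θ := θ n ω) (c := -(b * θ n ω ^ 2)) (g := k * η) (by nlinarith)
      ((le_div_iff₀ hη).1 hk1) (by have := (div_lt_iff₀ hη).1 hk2; linarith)
      (hval k (Finset.mem_Icc.2 ⟨by omega, by omega⟩) _ rfl)
      (hval (k - 3) (Finset.mem_Icc.2 ⟨by omega, by omega⟩) _ (by push_cast; ring))
      (hval (k + 3) (Finset.mem_Icc.2 ⟨by omega, by omega⟩) _ (by push_cast; ring))
    have hmem : δ ≤ |W n ω - θ n ω| := by simpa using hmem
    rw [hη_def] at hlt
    linarith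
  calc P {ω | δ ≤ ‖W n ω - θ n ω - (0 : Ω → ℝ) ω‖}
      ≤ P ({ω | K ≤ |θ n ω|} ∪ bad n ∪ ⋃ k ∈ G, {ω | t ≤ |X k n ω|}) := measure_mono_ae hsub
    _ ≤ P {ω | K ≤ |θ n ω|} + P (bad n) + ∑ k ∈ G, P {ω | t ≤ |X k n ω|} := by
        refine (measure_union_le _ _).trans (add_le_add (measure_union_le _ _) ?_)
        exact measure_biUnion_finset_le _ _
    _ ≤ τ / 3 + τ / 3 + τ / 3 := by gcongr
    _ = τ := ENNReal.add_thirds τ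

theorem tendstoInMeasure_prodMk_zero {X : ℕ → Ω → ℝ} {E : Type*} [SeminormedAddCommGroup E]
    {Z : ℕ → Ω → E} (hX : TendstoInMeasure P X atTop 0) (hZ : TendstoInMeasure P Z atTop 0) :
    TendstoInMeasure P (fun n ω ↦ (X n ω, Z n ω)) atTop 0 := by
  rw [tendstoInMeasure_iff_norm] at *
  intro δ hδ
  have h := (hX δ hδ).add (hZ δ hδ)
  rw [add_zero] at h
  refine tendsto_of_tendsto_of_tendsto_of_le_of_le tendsto_const_nhds h (fun n ↦ zero_le)
    fun n ↦ ?_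
  refine (measure_mono fun ω hω ↦ ?_).trans (measure_union_le _ _)
  have hω : δ ≤ ‖((X n ω, Z n ω) : ℝ × E)‖ := by simpa using hω
  rw [Prod.norm_def, le_max_iff] at hω
  simpa using hω

theorem tendstoInMeasure_zero_of_abs_le_add {X Y Z : ℕ → Ω → ℝ}
    (hX : TendstoInMeasure P X atTop 0) (hY : TendstoInMeasure P Y atTop 0)
    (hZ : ∀ n ω, |Z n ω| ≤ |X n ω| + |Y n ω|) : TendstoInMeasure P Z atTop 0 := by
  rw [tendstoInMeasure_iff_norm] at *
  intro δ hδ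
  have h := (hX (δ / 2) (by positivity)).add (hY (δ / 2) (by positivity))
  rw [add_zero] at h
  refine tendsto_of_tendsto_of_tendsto_of_le_of_le tendsto_const_nhds h (fun n ↦ zero_le)
    fun n ↦ ?_
  refine (measure_mono fun ω hω ↦ ?_).trans (measure_union_le _ _)
  have hω : δ ≤ |Z n ω| := by simpa using hω
  by_contra hnot
  have hnot : |X n ω| < δ / 2 ∧ |Y n ω| < δ / 2 := by simpa using hnot
  linarith [hZ n ω, hnot.1, hnot.2]

/-- Sequences that agree with probability tending to `1` have the same limit in distribution. -/
theorem tendstoInDistribution_of_tendsto_measure_ne [IsProbabilityMeasure P]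
    {Ω' : Type*} {mΩ' : MeasurableSpace Ω'} {P' : Measure Ω'} [IsProbabilityMeasure P']
    {X Y : ℕ → Ω → ℝ} {Z : Ω' → ℝ} (hX : TendstoInDistribution X atTop Z (fun _ ↦ P) P')
    (hY : ∀ n, AEMeasurable (Y n) P) {bad : ℕ → Set Ω}
    (hbad : Tendsto (fun n ↦ P (bad n)) atTop (𝓝 0))
    (hXY : ∀ᶠ n in atTop, ∀ ω, ω ∉ bad n → Y n ω = X n ω) :
    TendstoInDistribution Y atTop Z (fun _ ↦ P) P' := by
  refine tendstoInDistribution_of_tendstoInMeasure_sub Y Z hX ?_ hY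
  rw [tendstoInMeasure_iff_norm]
  intro δ hδ
  refine tendsto_of_tendsto_of_tendsto_of_le_of_le' tendsto_const_nhds hbad
    (Eventually.of_forall fun n ↦ zero_le) ?_
  filter_upwards [hXY] with n hn
  refine measure_mono fun ω hω ↦ ?_
  by_contra h
  have hω : δ ≤ ‖(Y - X) n ω - (0 : Ω → ℝ) ω‖ := hω
  simp [hn ω h] at hω
  linarith

end Argmin

/-! ### Algebra of the autoregression and its objective. -/

section Autoregression

theorem arPath_eq (ρ : ℝ) (κ : ℕ) (ε : ℤ → ℝ) (i : ℕ) :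
    arPath ρ κ ε i = ρ ^ i * arPath ρ κ ε 0 +
      ∑ k ∈ Finset.range i, ρ ^ (i - 1 - k) * ε ((k : ℤ) + 1) := by
  induction i with
  | zero => simp
  | succ i ih =>
    have h : arPath ρ κ ε (i + 1) = ρ * arPath ρ κ ε i + ε ((i : ℤ) + 1) := rfl
    rw [h, ih, Finset.sum_range_succ, mul_add, Finset.mul_sum, pow_succ]
    have hs : ∑ k ∈ Finset.range i, ρ * (ρ ^ (i - 1 - k) * ε ((k : ℤ) + 1)) =
        ∑ k ∈ Finset.range i, ρ ^ (i + 1 - 1 - k) * ε ((k : ℤ) + 1) := by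
      refine Finset.sum_congr rfl fun k hk ↦ ?_
      have hk := Finset.mem_range.1 hk
      have : i + 1 - 1 - k = (i - 1 - k) + 1 := by omega
      rw [this, pow_succ]; ring
    rw [hs]
    simp
    ring

theorem sum_Icc_one_eq_sum_range (f : ℕ → ℝ) (n : ℕ) :
    ∑ i ∈ Finset.Icc 1 n, f i = ∑ i ∈ Finset.range n, f (i + 1) := by
  induction n with
  | zero => simp
  | succ n ih => rw [Finset.sum_Icc_succ_top (by omega), ih, Finset.sum_range_succ]

theorem ladObjective_arPath (ρ : ℝ) (κ n : ℕ) (ε : ℤ → ℝ) (r : ℝ) :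
    ladObjective n (arPath ρ κ ε) r = (1 / (n : ℝ)) *
      ∑ i ∈ Finset.range n, |ε ((i : ℤ) + 1) - (r - ρ) * arPath ρ κ ε i| := by
  unfold ladObjective
  congr 1
  rw [sum_Icc_one_eq_sum_range]
  refine Finset.sum_congr rfl fun i _ ↦ ?_
  congr 1
  simp only [arPath, Nat.add_sub_cancel]
  ring

/-- The affine substitution `w = √n * y 0 * (r - ρ)` is invertible as `y 0 ≠ 0`, and the new
objective is `n` times the old one minus a quantity free of `w`. -/
theorem isMinOn_of_isLADEstimate {ρ : ℝ} {κ n : ℕ} {ε : ℤ → ℝ} {r : ℝ} (hn : 1 ≤ n)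
    (hr : IsLADEstimate n (arPath ρ κ ε) r) (h0 : arPath ρ κ ε 0 ≠ 0) {e : ℕ → ℝ}
    (he : ∀ i < n, 1 + e i = arPath ρ κ ε i / arPath ρ κ ε 0) :
    IsMinOn (fun w ↦ ∑ i ∈ Finset.range n,
      (|ε ((i : ℤ) + 1) - w * ((1 + e i) / √n)| - |ε ((i : ℤ) + 1)|)) Set.univ
      (√n * arPath ρ κ ε 0 * (r - ρ)) := by
  have hn0 : (0 : ℝ) < n := by exact_mod_cast hn
  have hsn : √(n : ℝ) ≠ 0 := (Real.sqrt_pos.2 hn0).ne'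
  have hterm (w : ℝ) (i : ℕ) (hi : i < n) : w * ((1 + e i) / √n) =
      (ρ + w / (√n * arPath ρ κ ε 0) - ρ) * arPath ρ κ ε i := by
    rw [he i hi]; field_simp; ring
  have hobj (w : ℝ) : ∑ i ∈ Finset.range n,
      (|ε ((i : ℤ) + 1) - w * ((1 + e i) / √n)| - |ε ((i : ℤ) + 1)|) =
      n * ladObjective n (arPath ρ κ ε) (ρ + w / (√n * arPath ρ κ ε 0)) -
      ∑ i ∈ Finset.range n, |ε ((i : ℤ) + 1)| := by
    rw [ladObjective_arPath, ← mul_assoc, mul_one_div_cancel hn0.ne', one_mul,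
      Finset.sum_sub_distrib]
    congr 1
    refine Finset.sum_congr rfl fun i hi ↦ ?_
    rw [hterm w i (Finset.mem_range.1 hi)]
  intro w _
  simp only [Set.mem_ofPred_eq]
  rw [hobj, hobj]
  have hrr : ρ + √n * arPath ρ κ ε 0 * (r - ρ) / (√n * arPath ρ κ ε 0) = r := by
    field_simp
    ring
  rw [hrr]
  gcongr
  exact hr (Set.mem_univ _)

/-- The reverse triangle inequality for the quadratic mean, with a constant vector. -/
theorem sq_sqrt_mean_sub_abs_le {n : ℕ} (hn : 1 ≤ n) (a : ℕ → ℝ) (v : ℝ) :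
    (√((n : ℝ)⁻¹ * ∑ i ∈ Finset.range n, a i ^ 2) - |v|) ^ 2 ≤
      (n : ℝ)⁻¹ * ∑ i ∈ Finset.range n, (a i - v) ^ 2 := by
  have hn0 : (0 : ℝ) < n := by exact_mod_cast hn
  set Q := (n : ℝ)⁻¹ * ∑ i ∈ Finset.range n, a i ^ 2
  set M := (n : ℝ)⁻¹ * ∑ i ∈ Finset.range n, a i
  have hQ : 0 ≤ Q := by positivity
  have hexp : (n : ℝ)⁻¹ * ∑ i ∈ Finset.range n, (a i - v) ^ 2 = Q - 2 * v * M + v ^ 2 := by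
    simp only [Q, M, sub_sq, Finset.sum_add_distrib, Finset.sum_sub_distrib, Finset.sum_const,
      Finset.card_range, nsmul_eq_mul, ← Finset.sum_mul, ← Finset.mul_sum]
    field_simp
  have hMQ : M ^ 2 ≤ Q := by
    have := sq_sum_le_card_mul_sum_sq (s := Finset.range n) (f := a)
    rw [Finset.card_range] at this
    simp only [M, Q, mul_pow]
    rw [inv_pow, inv_mul_le_iff₀ (by positivity)]
    calc _ ≤ _ := this
      _ = _ := by field_simp
  have hvM : v * M ≤ √Q * |v| := by
    have h1 : |M| ≤ √Q := Real.abs_le_sqrt hMQ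
    calc v * M ≤ |v * M| := le_abs_self _
      _ = |M| * |v| := by rw [abs_mul, mul_comm]
      _ ≤ _ := by gcongr
  rw [hexp, sub_sq, Real.sq_sqrt hQ, sq_abs]
  linarith

end Autoregression

/-! ### Second moments of the autoregression. -/

section SecondMoments

variable {Ω : Type*} {mΩ : MeasurableSpace Ω} {P : Measure Ω} {ε : ℤ → Ω → ℝ} {σ : ℝ}

theorem integral_sq_sum_mul (hindep : iIndepFun ε P) (hL2 : ∀ i, MemLp (ε i) 2 P)
    (hmean : ∀ i, ∫ ω, ε i ω ∂P = 0) (hvar : ∀ i, ∫ ω, ε i ω ^ 2 ∂P = σ ^ 2)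
    (s : Finset ℕ) (c : ℕ → ℝ) {φ : ℕ → ℤ} (hφ : Function.Injective φ) :
    ∫ ω, (∑ i ∈ s, c i * ε (φ i) ω) ^ 2 ∂P = σ ^ 2 * ∑ i ∈ s, c i ^ 2 := by
  rw [integral_sum_sq_of_orthogonal s fun i _ ↦ (hL2 _).const_mul (c i), Finset.mul_sum]
  · refine Finset.sum_congr rfl fun i _ ↦ ?_
    simp_rw [mul_pow]
    rw [integral_const_mul, hvar, mul_comm]
  · intro i _ j _ hij
    have h := (hindep.indepFun (hφ.ne hij)).integral_fun_mul_eq_mul_integral (hL2 _).1 (hL2 _).1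
    have heq : ∀ ω, c i * ε (φ i) ω * (c j * ε (φ j) ω) =
        c i * c j * (ε (φ i) ω * ε (φ j) ω) := fun ω ↦ by ring
    simp_rw [heq]
    rw [integral_const_mul, h, hmean, zero_mul, mul_zero]

theorem measurable_arPath (ρ : ℝ) (κ i : ℕ) :
    Measurable[pastSigma ε i] fun ω ↦ arPath ρ κ (fun k ↦ ε k ω) i := by
  induction i with
  | zero =>
    refine Finset.measurable_sum (m := pastSigma ε ((0 : ℕ) : ℤ)) _ fun j _ ↦ ?_
    exact (measurable_pastSigma (by simp)).const_mul _
  | succ i ih =>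
    exact ((ih.mono (pastSigma_mono (by simp)) le_rfl).const_mul ρ).add
      (measurable_pastSigma (by simp))

theorem memLp_arPath (hL2 : ∀ i, MemLp (ε i) 2 P) (ρ : ℝ) (κ i : ℕ) :
    MemLp (fun ω ↦ arPath ρ κ (fun k ↦ ε k ω) i) 2 P := by
  induction i with
  | zero => exact memLp_finsetSum _ fun j _ ↦ (hL2 _).const_mul _
  | succ i ih => exact (ih.const_mul ρ).add (hL2 _)

theorem integral_sq_arPath_zero_le (hindep : iIndepFun ε P) (hL2 : ∀ i, MemLp (ε i) 2 P)
    (hmean : ∀ i, ∫ ω, ε i ω ∂P = 0) (hvar : ∀ i, ∫ ω, ε i ω ^ 2 ∂P = σ ^ 2)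
    {ρ : ℝ} (hρ : 1 ≤ ρ) (κ : ℕ) :
    ∫ ω, arPath ρ κ (fun k ↦ ε k ω) 0 ^ 2 ∂P ≤ σ ^ 2 * ((κ + 1) * (ρ ^ κ) ^ 2) := by
  have h := integral_sq_sum_mul hindep hL2 hmean hvar (Finset.range (κ + 1)) (fun j ↦ ρ ^ j)
    (φ := fun j ↦ -(j : ℤ)) (fun i j h ↦ by simpa using h)
  simp only [arPath]
  rw [h]
  gcongr
  calc ∑ i ∈ Finset.range (κ + 1), (ρ ^ i) ^ 2
      ≤ ∑ i ∈ Finset.range (κ + 1), (ρ ^ κ) ^ 2 := by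
        refine Finset.sum_le_sum fun i hi ↦ ?_
        have := Finset.mem_range.1 hi
        gcongr
        omega
    _ = _ := by simp

/-- The increment is `(ρ ^ i - 1) * y 0` plus the noise accumulated since time `0`; the bound is
uniform in `i ≤ n`. -/
theorem integral_sq_arPath_sub_le (hindep : iIndepFun ε P) (hL2 : ∀ i, MemLp (ε i) 2 P)
    (hmean : ∀ i, ∫ ω, ε i ω ∂P = 0) (hvar : ∀ i, ∫ ω, ε i ω ^ 2 ∂P = σ ^ 2)
    {ρ : ℝ} (hρ : 1 ≤ ρ) (κ : ℕ) {i n : ℕ} (hin : i ≤ n) :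
    ∫ ω, (arPath ρ κ (fun k ↦ ε k ω) i - arPath ρ κ (fun k ↦ ε k ω) 0) ^ 2 ∂P ≤
      2 * ((ρ ^ n - 1) ^ 2 * (σ ^ 2 * ((κ + 1) * (ρ ^ κ) ^ 2)) + σ ^ 2 * (n * (ρ ^ n) ^ 2)) := by
  set Y : Ω → ℝ := fun ω ↦ arPath ρ κ (fun k ↦ ε k ω) 0
  set U : Ω → ℝ := fun ω ↦ ∑ k ∈ Finset.range i, ρ ^ (i - 1 - k) * ε ((k : ℤ) + 1) ω
  have hY : MemLp Y 2 P := memLp_arPath hL2 ρ κ 0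
  have hU : MemLp U 2 P := memLp_finsetSum _ fun j _ ↦ (hL2 _).const_mul _
  have hU2 : ∫ ω, U ω ^ 2 ∂P ≤ σ ^ 2 * (n * (ρ ^ n) ^ 2) := by
    have h := integral_sq_sum_mul hindep hL2 hmean hvar (Finset.range i)
      (fun k ↦ ρ ^ (i - 1 - k)) (φ := fun k ↦ (k : ℤ) + 1) (fun i j h ↦ by simpa using h)
    rw [h]
    gcongr
    calc ∑ k ∈ Finset.range i, (ρ ^ (i - 1 - k)) ^ 2
        ≤ ∑ k ∈ Finset.range i, (ρ ^ n) ^ 2 := by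
          refine Finset.sum_le_sum fun k _ ↦ ?_
          gcongr
          omega
      _ = i * (ρ ^ n) ^ 2 := by simp
      _ ≤ _ := by gcongr
  have hρi : 1 ≤ ρ ^ i := one_le_pow₀ hρ
  have hle (ω : Ω) : (arPath ρ κ (fun k ↦ ε k ω) i - Y ω) ^ 2 ≤
      2 * ((ρ ^ n - 1) ^ 2 * Y ω ^ 2 + U ω ^ 2) := by
    have h1 : arPath ρ κ (fun k ↦ ε k ω) i - Y ω = (ρ ^ i - 1) * Y ω + U ω := by
      rw [arPath_eq]; simp only [Y, U]; ring
    have h2 : (ρ ^ i - 1) ^ 2 ≤ (ρ ^ n - 1) ^ 2 := by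
      have : ρ ^ i ≤ ρ ^ n := pow_le_pow_right₀ hρ hin
      gcongr
    have h3 : (ρ ^ i - 1) ^ 2 * Y ω ^ 2 ≤ (ρ ^ n - 1) ^ 2 * Y ω ^ 2 := by gcongr
    rw [h1]
    nlinarith [sq_nonneg ((ρ ^ i - 1) * Y ω - U ω)]
  have hYi : Integrable (fun ω ↦ (ρ ^ n - 1) ^ 2 * Y ω ^ 2) P := hY.integrable_sq.const_mul _
  calc _ ≤ ∫ ω, 2 * ((ρ ^ n - 1) ^ 2 * Y ω ^ 2 + U ω ^ 2) ∂P :=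
        integral_mono ((memLp_arPath hL2 ρ κ i).sub hY).integrable_sq
          ((hYi.add hU.integrable_sq).const_mul 2) hle
    _ = 2 * ((ρ ^ n - 1) ^ 2 * ∫ ω, Y ω ^ 2 ∂P + ∫ ω, U ω ^ 2 ∂P) := by
        rw [integral_const_mul, integral_add hYi hU.integrable_sq, integral_const_mul]
    _ ≤ _ := by
        gcongr
        exact integral_sq_arPath_zero_le hindep hL2 hmean hvar hρ κ

/-- Squeeze between `1` and `exp (m (ρ - 1))`. -/
theorem tendsto_pow_of_tendsto_mul_sub_one {ρ : ℕ → ℝ} {m : ℕ → ℕ} (hρ : ∀ᶠ n in atTop, 1 ≤ ρ n)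
    (h : Tendsto (fun n ↦ (m n : ℝ) * (ρ n - 1)) atTop (𝓝 0)) :
    Tendsto (fun n ↦ ρ n ^ m n) atTop (𝓝 1) := by
  have hexp := (Real.continuous_exp.tendsto 0).comp h
  rw [Real.exp_zero] at hexp
  refine tendsto_of_tendsto_of_tendsto_of_le_of_le' tendsto_const_nhds hexp ?_ ?_
  · filter_upwards [hρ] with n hn using one_le_pow₀ hn
  · filter_upwards [hρ] with n hn
    simp only [Function.comp_apply]
    rw [mul_comm, Real.exp_mul, Real.rpow_natCast]
    gcongr
    linarith [Real.add_one_le_exp (ρ n - 1)]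

theorem tendsto_incrementBound {ρ : ℕ → ℝ} {κ : ℕ → ℕ} (hρ : ∀ n, 1 ≤ n → 1 < ρ n)
    (hnρ : Tendsto (fun n : ℕ ↦ (n : ℝ) * (ρ n - 1)) atTop (𝓝 0))
    (hκ : Tendsto (fun n : ℕ ↦ (κ n : ℝ) / (n : ℝ)) atTop atTop)
    (hκ' : Tendsto κ atTop atTop)
    (hκρ : Tendsto (fun n : ℕ ↦ (κ n : ℝ) * (ρ n - 1)) atTop (𝓝 0)) (σ : ℝ) :
    Tendsto (fun n : ℕ ↦ 2 * ((ρ n ^ n - 1) ^ 2 * (σ ^ 2 * ((κ n + 1) * (ρ n ^ κ n) ^ 2)) +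
      σ ^ 2 * (n * (ρ n ^ n) ^ 2)) / κ n) atTop (𝓝 0) := by
  have hρ' : ∀ᶠ n in atTop, 1 ≤ ρ n := by
    filter_upwards [eventually_ge_atTop 1] with n hn using (hρ n hn).le
  have h1 := tendsto_pow_of_tendsto_mul_sub_one (m := fun n ↦ n) hρ' hnρ
  have h2 := tendsto_pow_of_tendsto_mul_sub_one hρ' hκρ
  have h3 : Tendsto (fun n : ℕ ↦ (n : ℝ) / κ n) atTop (𝓝 0) := by
    refine (tendsto_inv_atTop_zero.comp hκ).congr fun n ↦ ?_
    simp
  have h4 : Tendsto (fun n : ℕ ↦ 1 + (κ n : ℝ)⁻¹) atTop (𝓝 (1 + 0)) :=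
    (tendsto_inv_atTop_zero.comp (tendsto_natCast_atTop_atTop.comp hκ')).const_add 1
  have h5 : Tendsto (fun n : ℕ ↦ 2 * ((ρ n ^ n - 1) ^ 2 * (σ ^ 2 * ((1 + (κ n : ℝ)⁻¹) *
      (ρ n ^ κ n) ^ 2)) + σ ^ 2 * ((n / κ n) * (ρ n ^ n) ^ 2))) atTop
      (𝓝 (2 * ((1 - 1) ^ 2 * (σ ^ 2 * ((1 + 0) * 1 ^ 2)) + σ ^ 2 * (0 * 1 ^ 2)))) :=
    ((((h1.sub_const 1).pow 2).mul ((h4.mul (h2.pow 2)).const_mul _)).add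
      ((h3.mul (h1.pow 2)).const_mul _)).const_mul 2
  have h6 : (2 * ((1 - 1) ^ 2 * (σ ^ 2 * ((1 + 0) * 1 ^ 2)) + σ ^ 2 * (0 * 1 ^ 2)) : ℝ) = 0 := by
    ring
  rw [h6] at h5
  refine h5.congr' ?_
  filter_upwards [hκ'.eventually_ge_atTop 1] with n hn
  have : (κ n : ℝ) ≠ 0 := by positivity
  field_simp

end SecondMoments

/-! ### Central limit theorems and independence of past and future. -/

section LimitLaws

variable {Ω : Type*} {mΩ : MeasurableSpace Ω} {P : Measure Ω} [IsProbabilityMeasure P]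
  {ε : ℤ → Ω → ℝ} {σ : ℝ}

theorem tendstoInDistribution_inv_sqrt_mul_sum_neg (hindep : iIndepFun ε P)
    (hident : ∀ i, IdentDistrib (ε i) (ε 1) P P)
    (hL2 : ∀ i, MemLp (ε i) 2 P) (hmean : ∀ i, ∫ ω, ε i ω ∂P = 0)
    (hvar : ∀ i, ∫ ω, ε i ω ^ 2 ∂P = σ ^ 2) {κ : ℕ → ℕ} (hκ : Tendsto κ atTop atTop) :
    TendstoInDistribution
      (fun n ω ↦ (√(κ n))⁻¹ * ∑ j ∈ Finset.range (κ n), ε (-(j : ℤ)) ω) atTop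
      (fun v : ℝ ↦ σ * v) (fun _ ↦ P) (gaussianReal 0 1) := by
  have hV : variance (ε (-((0 : ℕ) : ℤ))) P = σ ^ 2 := by
    rw [variance_of_integral_eq_zero (hL2 _).1.aemeasurable (hmean _), hvar]
  have hlaw : HasLaw (fun v : ℝ ↦ σ * v)
      (gaussianReal 0 (variance (ε (-((0 : ℕ) : ℤ))) P).toNNReal) (gaussianReal 0 1) := by
    refine ⟨by fun_prop, ?_⟩
    rw [gaussianReal_map_const_mul, hV]
    congr 1
    · simp
    · ext; simp [sq_nonneg]
  have h := tendstoInDistribution_inv_sqrt_mul_sum_sub (X := fun j : ℕ ↦ ε (-(j : ℤ))) hlaw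
    (hL2 _) (hindep.precomp (g := fun j : ℕ ↦ -(j : ℤ)) fun i j h ↦ by simpa using h)
    (fun i ↦ (hident _).trans (hident _).symm)
  simp only [hmean, mul_zero, sub_zero] at h
  -- The central limit theorem is read along the indices `κ n`, which need not be monotone but tend
  -- to infinity.
  exact ⟨fun n ↦ h.forall_aemeasurable (κ n), h.aemeasurable_limit, h.tendsto.comp hκ⟩

theorem tendstoInDistribution_inv_sqrt_mul_sum_signPos (hindep : iIndepFun ε P)
    (hident : ∀ i, IdentDistrib (ε i) (ε 1) P P) (hs : ∫ ω, signPos (ε 1 ω) ∂P = 0) :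
    TendstoInDistribution
      (fun (n : ℕ) ω ↦ (√n)⁻¹ * ∑ i ∈ Finset.range n, signPos (ε ((i : ℤ) + 1) ω)) atTop
      (fun v : ℝ ↦ v) (fun _ ↦ P) (gaussianReal 0 1) := by
  refine tendstoInDistribution_inv_sqrt_mul_sum
    (X := fun (i : ℕ) ω ↦ signPos (ε ((i : ℤ) + 1) ω)) HasLaw.id ?_ ?_ ?_ ?_
  · simpa using hs
  · simp [signPos_sq]
  · exact (hindep.precomp (g := fun j : ℕ ↦ (j : ℤ) + 1) fun i j h ↦ by simpa using h).comp
      (fun _ ↦ signPos) fun _ ↦ measurable_signPos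
  · exact fun i ↦ ((hident _).trans (hident _).symm).comp measurable_signPos

omit [IsProbabilityMeasure P] in
theorem indepFun_sum_nonpos_sum_pos (hmeas : ∀ i, Measurable (ε i)) (hindep : iIndepFun ε P)
    (k n : ℕ) (c d : ℝ) :
    IndepFun (fun ω ↦ c * ∑ j ∈ Finset.range k, ε (-(j : ℤ)) ω)
      (fun ω ↦ d * ∑ i ∈ Finset.range n, signPos (ε ((i : ℤ) + 1) ω)) P := by
  have h := indep_iSup_of_disjoint (fun k ↦ (hmeas k).comap_le) hindep.iIndep
    (S := Set.Iic 0) (T := Set.Ici 1) (by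
      rw [Set.disjoint_left]; intro x (hx : x ≤ 0) (hx' : 1 ≤ x); omega)
  rw [IndepFun_iff_Indep]
  refine indep_of_indep_of_le_left (indep_of_indep_of_le_right h ?_) ?_
  · refine Measurable.comap_le ?_
    refine Measurable.const_mul (Finset.measurable_sum (m := ⨆ k ∈ Set.Ici (1 : ℤ), _) _
      fun i _ ↦ measurable_signPos.comp ?_) _
    exact (comap_measurable (ε ((i : ℤ) + 1))).mono
      (le_iSup₂ (f := fun k (_ : k ∈ Set.Ici (1 : ℤ)) ↦
        MeasurableSpace.comap (ε k) inferInstance) ((i : ℤ) + 1) (by simp)) le_rfl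
  · refine Measurable.comap_le ?_
    refine Measurable.const_mul (Finset.measurable_sum (m := pastSigma ε 0) _
      fun i _ ↦ ?_) _
    exact measurable_pastSigma (by simp)

theorem tendsto_integral_abs_arPath_zero_sub (hindep : iIndepFun ε P)
    (hL2 : ∀ i, MemLp (ε i) 2 P) (hmean : ∀ i, ∫ ω, ε i ω ∂P = 0)
    (hvar : ∀ i, ∫ ω, ε i ω ^ 2 ∂P = σ ^ 2) {ρ : ℕ → ℝ} {κ : ℕ → ℕ}
    (hρ : ∀ᶠ n in atTop, 1 ≤ ρ n) (hκ : Tendsto κ atTop atTop)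
    (hκρ : Tendsto (fun n : ℕ ↦ (κ n : ℝ) * (ρ n - 1)) atTop (𝓝 0)) :
    Tendsto (fun n ↦ ∫ ω, |arPath (ρ n) (κ n) (fun k ↦ ε k ω) 0 / √(κ n) -
      (√(κ n))⁻¹ * ∑ j ∈ Finset.range (κ n), ε (-(j : ℤ)) ω| ∂P) atTop (𝓝 0) := by
  -- The initial value has `κ n + 1` terms and the comparison sum only `κ n`, so the term `j = κ n`
  -- keeps its full weight; it is negligible after division by `√(κ n)`.
  set c : ℕ → ℕ → ℝ := fun n j ↦ (√(κ n))⁻¹ * (if j < κ n then ρ n ^ j - 1 else ρ n ^ j) with hc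
  have heq (n : ℕ) (ω : Ω) : arPath (ρ n) (κ n) (fun k ↦ ε k ω) 0 / √(κ n) -
      (√(κ n))⁻¹ * ∑ j ∈ Finset.range (κ n), ε (-(j : ℤ)) ω =
      ∑ j ∈ Finset.range (κ n + 1), c n j * ε (-(j : ℤ)) ω := by
    simp only [arPath, hc]
    rw [Finset.sum_range_succ, Finset.sum_range_succ, if_neg (lt_irrefl _), div_eq_inv_mul, mul_add,
      Finset.mul_sum, Finset.mul_sum, ← mul_assoc, add_sub_right_comm, ← Finset.sum_sub_distrib]
    congr 1
    refine Finset.sum_congr rfl fun j hj ↦ ?_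
    rw [if_pos (Finset.mem_range.1 hj)]; ring
  have hbound : Tendsto (fun n ↦ √(σ ^ 2 * ((ρ n ^ κ n - 1) ^ 2 + (κ n : ℝ)⁻¹ *
      (ρ n ^ κ n) ^ 2))) atTop (𝓝 0) := by
    have h2 := tendsto_pow_of_tendsto_mul_sub_one hρ hκρ
    have h4 : Tendsto (fun n : ℕ ↦ (κ n : ℝ)⁻¹) atTop (𝓝 0) :=
      tendsto_inv_atTop_zero.comp (tendsto_natCast_atTop_atTop.comp hκ)
    have := ((((h2.sub_const 1).pow 2).add (h4.mul (h2.pow 2))).const_mul (σ ^ 2)).sqrt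
    simpa using this
  refine squeeze_zero' (Eventually.of_forall fun n ↦ integral_nonneg fun ω ↦ abs_nonneg _) ?_ hbound
  filter_upwards [hρ, hκ.eventually_ge_atTop 1] with n hn hκn
  have hκ0 : (0 : ℝ) < κ n := by exact_mod_cast hκn
  simp_rw [heq]
  refine integral_abs_le_of_integral_sq_le (memLp_finsetSum _ fun j _ ↦ (hL2 _).const_mul _)
    (Real.sqrt_nonneg _) ?_
  rw [Real.sq_sqrt (by positivity), integral_sq_sum_mul hindep hL2 hmean hvar _ _
    (φ := fun j ↦ -(j : ℤ)) (fun i j h ↦ by simpa using h)]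
  gcongr
  rw [Finset.sum_range_succ]
  have hsq : ((√(κ n : ℝ))⁻¹) ^ 2 = (κ n : ℝ)⁻¹ := by rw [inv_pow, Real.sq_sqrt hκ0.le]
  refine add_le_add ?_ (le_of_eq ?_)
  · calc ∑ j ∈ Finset.range (κ n), c n j ^ 2
        ≤ ∑ j ∈ Finset.range (κ n), (κ n : ℝ)⁻¹ * (ρ n ^ κ n - 1) ^ 2 := by
          refine Finset.sum_le_sum fun j hj ↦ ?_
          have hj := Finset.mem_range.1 hj
          simp only [hc]
          rw [if_pos hj, mul_pow, hsq]
          have h1 : 1 ≤ ρ n ^ j := one_le_pow₀ hn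
          have h2 : ρ n ^ j ≤ ρ n ^ κ n := pow_le_pow_right₀ hn hj.le
          gcongr
      _ = _ := by
          rw [Finset.sum_const, Finset.card_range, nsmul_eq_mul, ← mul_assoc,
            mul_inv_cancel₀ hκ0.ne', one_mul]
  · simp only [hc]
    rw [if_neg (lt_irrefl _), mul_pow, hsq]

end LimitLaws

/-! ### The median condition. -/

section NoiseFacts

variable {Ω : Type*} {mΩ : MeasurableSpace Ω} {P : Measure Ω} [IsProbabilityMeasure P]

/-- Without an atom at `0` the two median inequalities force `P {0 < X} = 1 / 2`. -/
theorem integral_signPos_eq_zero {X : Ω → ℝ} (hX : Measurable X) (h0 : P {ω | X ω = 0} = 0)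
    (hle : 1 / 2 ≤ P {ω | X ω ≤ 0}) (hge : 1 / 2 ≤ P {ω | 0 ≤ X ω}) :
    ∫ ω, signPos (X ω) ∂P = 0 := by
  have hpos : MeasurableSet {ω | 0 < X ω} := measurableSet_lt measurable_const hX
  have heq (ω : Ω) : signPos (X ω) = 2 * {ω | 0 < X ω}.indicator 1 ω - 1 := by
    unfold signPos
    by_cases h : 0 < X ω
    · rw [if_pos h, Set.indicator_of_mem (show ω ∈ {ω | 0 < X ω} from h)]; norm_num
    · rw [if_neg h, Set.indicator_of_notMem (show ω ∉ {ω | 0 < X ω} from h)]; norm_num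
  have hcompl : {ω | X ω ≤ 0} = {ω | 0 < X ω}ᶜ := by ext ω; simp
  have hge' : P {ω | 0 ≤ X ω} ≤ P {ω | 0 < X ω} := by
    calc _ ≤ P ({ω | 0 < X ω} ∪ {ω | X ω = 0}) := by
          refine measure_mono fun ω (hω : 0 ≤ X ω) ↦ ?_
          rcases hω.lt_or_eq with h | h
          · exact Or.inl h
          · exact Or.inr h.symm
      _ ≤ _ := (measure_union_le _ _).trans (by rw [h0, add_zero])
  have h1 : 1 / 2 ≤ P.real {ω | 0 < X ω} := by
    have := ENNReal.toReal_mono (measure_ne_top _ _) (hge.trans hge')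
    simpa [Measure.real] using this
  have h2 : 1 / 2 ≤ 1 - P.real {ω | 0 < X ω} := by
    rw [← probReal_compl_eq_one_sub hpos, ← hcompl]
    have := ENNReal.toReal_mono (measure_ne_top _ _) hle
    simpa [Measure.real] using this
  simp_rw [heq]
  have hint : Integrable ({ω | 0 < X ω}.indicator (1 : Ω → ℝ)) P :=
    (integrable_const (1 : ℝ)).indicator hpos
  rw [integral_sub (hint.const_mul 2) (integrable_const _),
    integral_const_mul, integral_indicator_one hpos]
  simp
  linarith

end NoiseFacts

/-! ### Linearisation of the estimator and its random normalisation. -/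

section Estimator

variable {Ω : Type*} {mΩ : MeasurableSpace Ω} {P : Measure Ω} [IsProbabilityMeasure P]
  {ε : ℤ → Ω → ℝ} {σ b : ℝ} {ρ : ℕ → ℝ} {κ : ℕ → ℕ}

/-- The least absolute deviation estimator, normalised by the initial value of the
autoregression, is asymptotically equivalent to the normalised median of the noise. -/
theorem tendstoInMeasure_lad_sub (hmeas : ∀ i, Measurable (ε i))
    (hindep : iIndepFun ε P) (hident : ∀ i, IdentDistrib (ε i) (ε 1) P P)
    (hL2 : ∀ i, MemLp (ε i) 2 P) (hmean : ∀ i, ∫ ω, ε i ω ∂P = 0)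
    (hvar : ∀ i, ∫ ω, ε i ω ^ 2 ∂P = σ ^ 2)
    (hs : ∫ ω, signPos (ε 1 ω) ∂P = 0) {C : ℝ} (hC0 : 0 ≤ C)
    (hC : ∀ t, 0 ≤ t → P {ω | |ε 1 ω| ≤ t} ≤ ENNReal.ofReal (C * t)) (hb : 0 < b)
    (hquad : ∀ η > 0, ∃ c > 0, ∀ a, |a| ≤ c →
      |∫ ω, absRem a (ε 1 ω) ∂P - b * a ^ 2| ≤ η * a ^ 2)
    (hρ : ∀ n, 1 ≤ n → 1 < ρ n)
    (hbound : Tendsto (fun n : ℕ ↦ 2 * ((ρ n ^ n - 1) ^ 2 *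
      (σ ^ 2 * ((κ n + 1) * (ρ n ^ κ n) ^ 2)) + σ ^ 2 * (n * (ρ n ^ n) ^ 2)) / κ n) atTop (𝓝 0))
    (hV : ∀ τ : ENNReal, 0 < τ → ∃ δ : ℝ, 0 < δ ∧ ∀ᶠ n in atTop,
      P {ω | |arPath (ρ n) (κ n) (fun k ↦ ε k ω) 0 / √(κ n)| < δ} < τ)
    {r : ℕ → Ω → ℝ} (hr : ∀ n, 1 ≤ n → ∀ᵐ ω ∂P,
      IsLADEstimate n (arPath (ρ n) (κ n) fun k ↦ ε k ω) (r n ω)) :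
    TendstoInMeasure P (fun (n : ℕ) ω ↦
      √n * arPath (ρ n) (κ n) (fun k ↦ ε k ω) 0 * (r n ω - ρ n) -
      (2 * b)⁻¹ * ((√n)⁻¹ * ∑ i ∈ Finset.range n, signPos (ε ((i : ℤ) + 1) ω))) atTop 0 := by
  refine tendstoInMeasure_argmin_sub hb (fun τ hτ ↦ ?_) fun τ hτ ↦ ?_
  · have h1 := (tendstoInDistribution_inv_sqrt_mul_sum_signPos hindep hident hs).continuous_comp
      (g := fun x ↦ |(2 * b)⁻¹ * x|) (by fun_prop)
    obtain ⟨m, hm⟩ := exists_eventually_measure_preimage_lt h1 (C := fun m : ℕ ↦ Set.Ici (m : ℝ))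
      (fun i j hij ↦ Set.Ici_subset_Ici.2 (by exact_mod_cast hij)) (fun m ↦ isClosed_Ici)
      (Eventually.of_forall fun ω ↦ by simpa using exists_nat_gt _) hτ
    exact ⟨m, hm⟩
  obtain ⟨δ, hδ, hδV⟩ := hV τ hτ
  set y : ℕ → ℕ → Ω → ℝ := fun n i ω ↦ arPath (ρ n) (κ n) (fun k ↦ ε k ω) i with hy
  -- Setting `e` to `0` where `|V| < δ` keeps it adapted and bounds its second moment by `B n / δ²`.
  -- The identity `1 + e i = y i / y 0` is lost only there, and that event serves as the bad set.
  set e : ℕ → ℕ → Ω → ℝ := fun n i ω ↦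
    if δ ≤ |y n 0 ω / √(κ n)| then (y n i ω - y n 0 ω) / √(κ n) / (y n 0 ω / √(κ n)) else 0 with he
  set B : ℕ → ℝ := fun n ↦ 2 * ((ρ n ^ n - 1) ^ 2 *
      (σ ^ 2 * ((κ n + 1) * (ρ n ^ κ n) ^ 2)) + σ ^ 2 * (n * (ρ n ^ n) ^ 2)) / κ n with hB
  have hB0 (n : ℕ) : 0 ≤ B n := by positivity
  have hemeas (n i : ℕ) : Measurable[pastSigma ε i] (e n i) := by
    have h0 : Measurable[pastSigma ε i] (y n 0) :=
      (measurable_arPath (ρ n) (κ n) 0).mono (pastSigma_mono (by simp)) le_rfl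
    have hi : Measurable[pastSigma ε i] (y n i) := measurable_arPath (ρ n) (κ n) i
    refine Measurable.ite ?_ (((hi.sub h0).div_const _).div (h0.div_const _)) measurable_const
    exact (continuous_abs.measurable.comp (h0.div_const _)) measurableSet_Ici
  have hele (n i : ℕ) (ω : Ω) : e n i ω ^ 2 ≤ (κ n : ℝ)⁻¹ * (δ ^ 2)⁻¹ * (y n i ω - y n 0 ω) ^ 2 := by
    simp only [he]
    split_ifs with h
    · rw [div_pow, div_pow _ (√(κ n : ℝ)), Real.sq_sqrt (Nat.cast_nonneg _), ← sq_abs (y n 0 ω / _)]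
      calc _ ≤ (y n i ω - y n 0 ω) ^ 2 / κ n / δ ^ 2 := by gcongr
        _ = _ := by ring
    · rw [zero_pow two_ne_zero]; positivity
  have hdL2 (n i : ℕ) : MemLp (fun ω ↦ y n i ω - y n 0 ω) 2 P :=
    (memLp_arPath hL2 _ _ _).sub (memLp_arPath hL2 _ _ _)
  have hem (n i : ℕ) : AEStronglyMeasurable (e n i) P :=
    ((hemeas n i).mono (pastSigma_le hmeas _) le_rfl).aestronglyMeasurable
  have heL2 (n i : ℕ) : MemLp (e n i) 2 P := by
    rw [memLp_two_iff_integrable_sq (hem n i)]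
    refine ((hdL2 n i).integrable_sq.const_mul ((κ n : ℝ)⁻¹ * (δ ^ 2)⁻¹)).mono'
      ((hem n i).pow 2) (Eventually.of_forall fun ω ↦ ?_)
    rw [Real.norm_of_nonneg (sq_nonneg _)]
    exact hele n i ω
  have heη (n i : ℕ) (hi : i < n) : ∫ ω, e n i ω ^ 2 ∂P ≤ (√(B n) / δ) ^ 2 := by
    rw [div_pow, Real.sq_sqrt (hB0 n)]
    calc ∫ ω, e n i ω ^ 2 ∂P
        ≤ ∫ ω, (κ n : ℝ)⁻¹ * (δ ^ 2)⁻¹ * (y n i ω - y n 0 ω) ^ 2 ∂P :=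
          integral_mono (heL2 n i).integrable_sq ((hdL2 n i).integrable_sq.const_mul _) (hele n i)
      _ ≤ (κ n : ℝ)⁻¹ * (δ ^ 2)⁻¹ * (2 * ((ρ n ^ n - 1) ^ 2 *
          (σ ^ 2 * ((κ n + 1) * (ρ n ^ κ n) ^ 2)) + σ ^ 2 * (n * (ρ n ^ n) ^ 2))) := by
          rw [integral_const_mul]
          gcongr
          exact integral_sq_arPath_sub_le hindep hL2 hmean hvar (hρ n (by omega)).le _ hi.le
      _ = _ := by simp only [hB]; ring
  have hη0 : Tendsto (fun n ↦ √(B n) / δ) atTop (𝓝 0) := by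
    have := hbound.sqrt.div_const δ
    simpa using this
  refine ⟨fun n ω w ↦ ∑ i ∈ Finset.range n,
    (|ε ((i : ℤ) + 1) ω - w * ((1 + e n i ω) / √n)| - |ε ((i : ℤ) + 1) ω|),
    fun n ↦ {ω | |y n 0 ω / √(κ n)| < δ}, hδV,
    fun n ω ↦ convexOn_sum_abs_sub_mul _ _ _, ?_, fun w ↦ ?_⟩
  · filter_upwards [eventually_ge_atTop 1] with n hn
    filter_upwards [hr n hn] with ω hω hbad
    have hbad : δ ≤ |y n 0 ω / √(κ n)| := not_lt.1 hbad
    have hV0 : y n 0 ω / √(κ n) ≠ 0 := abs_pos.1 (hδ.trans_le hbad)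
    have hy0 : y n 0 ω ≠ 0 := fun h ↦ hV0 (by rw [h, zero_div])
    have hκ0 : √(κ n : ℝ) ≠ 0 := fun h ↦ hV0 (by rw [h, div_zero])
    refine isMinOn_of_isLADEstimate hn hω hy0 (e := fun i ↦ e n i ω) fun i _ ↦ ?_
    simp only [he]
    rw [if_pos hbad]
    change 1 + (y n i ω - y n 0 ω) / √(κ n) / (y n 0 ω / √(κ n)) = y n i ω / y n 0 ω
    field_simp
    ring
  · obtain ⟨h1, h2⟩ := tendsto_integral_abs_loss_sub hmeas hindep hident hs hC0 hC hquad
      (fun n i _ ↦ hemeas n i) (fun n i _ ↦ heL2 n i) (fun n ↦ by positivity) heη hη0 w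
    refine (tendstoInMeasure_zero_of_integral_abs_tendsto h1 h2).congr_left fun n ↦ ?_
    filter_upwards with ω
    have : 2 * b * ((2 * b)⁻¹ * ((√n)⁻¹ * ∑ i ∈ Finset.range n, signPos (ε ((i : ℤ) + 1) ω))) =
      (√n)⁻¹ * ∑ i ∈ Finset.range n, signPos (ε ((i : ℤ) + 1) ω) := by
      rw [← mul_assoc, mul_inv_cancel₀ (by positivity), one_mul]
    rw [this]

/-- By the reverse triangle inequality, replacing every `y i` by `y 0` in the quadratic mean costs
no more than the mean square increment. -/
theorem tendsto_integral_abs_sqrt_mean_sub (hindep : iIndepFun ε P)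
    (hL2 : ∀ i, MemLp (ε i) 2 P) (hmean : ∀ i, ∫ ω, ε i ω ∂P = 0)
    (hvar : ∀ i, ∫ ω, ε i ω ^ 2 ∂P = σ ^ 2) (hρ : ∀ n, 1 ≤ n → 1 < ρ n)
    (hbound : Tendsto (fun n : ℕ ↦ 2 * ((ρ n ^ n - 1) ^ 2 *
      (σ ^ 2 * ((κ n + 1) * (ρ n ^ κ n) ^ 2)) + σ ^ 2 * (n * (ρ n ^ n) ^ 2)) / κ n) atTop (𝓝 0)) :
    (∀ n : ℕ, Integrable (fun ω ↦ √((n : ℝ)⁻¹ * ∑ i ∈ Finset.range n,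
      (arPath (ρ n) (κ n) (fun k ↦ ε k ω) i / √(κ n)) ^ 2) -
      |arPath (ρ n) (κ n) (fun k ↦ ε k ω) 0 / √(κ n)|) P) ∧
    Tendsto (fun n : ℕ ↦ ∫ ω, |(√((n : ℝ)⁻¹ * ∑ i ∈ Finset.range n,
      (arPath (ρ n) (κ n) (fun k ↦ ε k ω) i / √(κ n)) ^ 2) -
      |arPath (ρ n) (κ n) (fun k ↦ ε k ω) 0 / √(κ n)|)| ∂P) atTop (𝓝 0) := by
  set z : ℕ → ℕ → Ω → ℝ := fun n i ω ↦ arPath (ρ n) (κ n) (fun k ↦ ε k ω) i / √(κ n)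
  set B : ℕ → ℝ := fun n ↦ 2 * ((ρ n ^ n - 1) ^ 2 *
      (σ ^ 2 * ((κ n + 1) * (ρ n ^ κ n) ^ 2)) + σ ^ 2 * (n * (ρ n ^ n) ^ 2)) / κ n with hB
  have hz (n i : ℕ) : MemLp (z n i) 2 P := by
    have := (memLp_arPath hL2 (ρ n) (κ n) i).const_mul (√(κ n))⁻¹
    refine this.ae_eq (Eventually.of_forall fun ω ↦ ?_)
    simp only [z]; ring
  have hNm (n : ℕ) : AEMeasurable (fun ω ↦ √((n : ℝ)⁻¹ * ∑ i ∈ Finset.range n, z n i ω ^ 2)) P :=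
    ((Finset.aemeasurable_fun_sum _ fun i _ ↦ (hz n i).1.aemeasurable.pow_const 2).const_mul
      _).sqrt
  have hdm (n : ℕ) : AEStronglyMeasurable
      (fun ω ↦ √((n : ℝ)⁻¹ * ∑ i ∈ Finset.range n, z n i ω ^ 2) - |z n 0 ω|) P :=
    ((hNm n).sub (hz n 0).1.aemeasurable.abs).aestronglyMeasurable
  have hdz (n : ℕ) : Integrable (fun ω ↦ (n : ℝ)⁻¹ *
      ∑ i ∈ Finset.range n, (z n i ω - z n 0 ω) ^ 2) P :=
    (integrable_finsetSum _ fun i _ ↦ ((hz n i).sub (hz n 0)).integrable_sq).const_mul _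
  have hmem (n : ℕ) : MemLp
      (fun ω ↦ √((n : ℝ)⁻¹ * ∑ i ∈ Finset.range n, z n i ω ^ 2) - |z n 0 ω|) 2 P := by
    rcases Nat.eq_zero_or_pos n with rfl | hn
    -- For `n = 0` the quadratic mean is `0`, leaving `-|z 0 0|`.
    · exact (hz 0 0).norm.neg.ae_eq (Eventually.of_forall fun ω ↦ by simp)
    rw [memLp_two_iff_integrable_sq (hdm n)]
    refine (hdz n).mono' ((hdm n).pow 2) (Eventually.of_forall fun ω ↦ ?_)
    rw [Real.norm_of_nonneg (sq_nonneg _)]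
    exact sq_sqrt_mean_sub_abs_le hn _ _
  refine ⟨fun n ↦ (hmem n).integrable one_le_two, ?_⟩
  have hbound' : Tendsto (fun n ↦ √(B n)) atTop (𝓝 0) := by simpa using hbound.sqrt
  refine squeeze_zero' (Eventually.of_forall fun n ↦ integral_nonneg fun ω ↦ abs_nonneg _) ?_
    hbound'
  filter_upwards [eventually_ge_atTop 1] with n hn
  refine integral_abs_le_of_integral_sq_le (hmem n) (Real.sqrt_nonneg _) ?_
  rw [Real.sq_sqrt (by positivity)]
  have hn0 : (0 : ℝ) < n := by exact_mod_cast hn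
  have hdzi (i : ℕ) : Integrable (fun ω ↦ (z n i ω - z n 0 ω) ^ 2) P :=
    ((hz n i).sub (hz n 0)).integrable_sq
  calc _ ≤ ∫ ω, (n : ℝ)⁻¹ * ∑ i ∈ Finset.range n, (z n i ω - z n 0 ω) ^ 2 ∂P :=
        integral_mono (hmem n).integrable_sq (hdz n) fun ω ↦ sq_sqrt_mean_sub_abs_le hn _ _
    _ = (n : ℝ)⁻¹ * ∑ i ∈ Finset.range n, ∫ ω, (z n i ω - z n 0 ω) ^ 2 ∂P := by
        rw [integral_const_mul, integral_finsetSum _ fun i _ ↦ hdzi i]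
    _ ≤ (n : ℝ)⁻¹ * ∑ i ∈ Finset.range n, B n := by
        gcongr with i hi
        have hi := Finset.mem_range.1 hi
        have h1 (ω : Ω) : (z n i ω - z n 0 ω) ^ 2 = (κ n : ℝ)⁻¹ *
            (arPath (ρ n) (κ n) (fun k ↦ ε k ω) i - arPath (ρ n) (κ n) (fun k ↦ ε k ω) 0) ^ 2 := by
          simp only [z]
          rw [← sub_div, div_pow, Real.sq_sqrt (Nat.cast_nonneg _)]; ring
        simp_rw [h1]
        rw [integral_const_mul]
        simp only [hB]
        rw [div_eq_inv_mul]
        gcongr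
        exact integral_sq_arPath_sub_le hindep hL2 hmean hvar (hρ n (by omega)).le _ hi.le
    _ = B n := by
        rw [Finset.sum_const, Finset.card_range, nsmul_eq_mul, ← mul_assoc,
          inv_mul_cancel₀ hn0.ne', one_mul]

end Estimator

/-! ### Mapping away from the null set, and the main theorem. -/

section Main

variable {Ω : Type*} {mΩ : MeasurableSpace Ω} {P : Measure Ω} [IsProbabilityMeasure P]

/-- If `(X n, Y n)` and an asymptotically equivalent sequence converge in distribution, so does
the image under a map that is continuous off the null set `{v = 0}`, even when the image is
modified on `{v = 0}`. -/
theorem tendstoInDistribution_of_eq_off_zero {E : Type*} [TopologicalSpace E] [MeasurableSpace E]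
    [BorelSpace E] [HasOuterApproxClosed (ℝ × E)] [BorelSpace (ℝ × E)]
    {Ω' : Type*} {mΩ' : MeasurableSpace Ω'} {P' : Measure Ω'} [IsProbabilityMeasure P']
    {B : ℕ → Ω → ℝ × E} {Z : Ω' → ℝ × E} (hB : TendstoInDistribution B atTop Z (fun _ ↦ P) P')
    (hZ : ∀ᵐ ω ∂P', (Z ω).1 ≠ 0) {g : ℝ × E → ℝ} (hg : Measurable g)
    (hcont : ∀ p : ℝ × E, p.1 ≠ 0 → ContinuousAt g p) {Y : ℕ → Ω → ℝ}
    (hY : ∀ n, AEMeasurable (Y n) P)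
    (hYB : ∀ᶠ n in atTop, ∀ ω, (B n ω).1 ≠ 0 → Y n ω = g (B n ω)) :
    TendstoInDistribution Y atTop (fun ω ↦ g (Z ω)) (fun _ ↦ P) P' := by
  have hlim := tendstoInDistribution_comp_of_ae_continuousAt hB hg
    (hZ.mono fun ω hω ↦ hcont _ hω)
  have hclosed : IsClosed {p : ℝ × E | p.1 = 0} := isClosed_eq continuous_fst continuous_const
  have hbad : Tendsto (fun n ↦ P (B n ⁻¹' {p : ℝ × E | p.1 = 0})) atTop (𝓝 0) := by
    have h1 := limsup_measure_preimage_closed_le hB hclosed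
    have h0 : P' (Z ⁻¹' {p : ℝ × E | p.1 = 0}) = 0 := by
      refine measure_mono_null (fun ω hω ↦ ?_) (ae_iff.1 hZ)
      simpa using hω
    rw [h0] at h1
    exact tendsto_of_le_liminf_of_limsup_le (by simp) h1
  exact tendstoInDistribution_of_tendsto_measure_ne hlim hY hbad
    (hYB.mono fun n hn ω hω ↦ hn ω hω)

end Main

theorem mainTheorem2 {Ω : Type*} [MeasurableSpace Ω] (P : Measure Ω) [IsProbabilityMeasure P]
    -- the noise: i.i.d., mean zero, finite variance `σ ^ 2`
    (ε : ℤ → Ω → ℝ) (hmeas : ∀ i, Measurable (ε i)) (hindep : iIndepFun ε P)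
    (hident : ∀ i, IdentDistrib (ε i) (ε 1) P P)
    (hL2 : MemLp (ε 1) 2 P) (hmean : ∫ ω, ε 1 ω ∂P = 0)
    (σ : ℝ) (hσ : 0 ≤ σ) (hvar : variance (ε 1) P = σ ^ 2)
    -- zero is a median of the noise
    (hmedle : 1 / 2 ≤ P {ω | ε 1 ω ≤ 0}) (hmedge : 1 / 2 ≤ P {ω | 0 ≤ ε 1 ω})
    -- the noise has a differentiable density `f` with `f 0 > 0` and bounded derivative
    (f : ℝ → ℝ) (hf_nonneg : ∀ x, 0 ≤ f x)
    (hf_density : P.map (ε 1) = volume.withDensity (fun x ↦ ENNReal.ofReal (f x)))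
    (hf_diff : Differentiable ℝ f) (hf_zero : 0 < f 0)
    (hf_deriv : BddAbove (Set.range fun x ↦ |deriv f x|))
    -- the autoregressive parameters and the length of the initialisation
    (ρ : ℕ → ℝ) (κ : ℕ → ℕ) (hρ : ∀ n, 1 ≤ n → 1 < ρ n)
    (hnρ : Tendsto (fun n : ℕ ↦ (n : ℝ) * (ρ n - 1)) atTop (𝓝 0))
    (hκ : Tendsto (fun n : ℕ ↦ (κ n : ℝ) / (n : ℝ)) atTop atTop)
    (hκρ : Tendsto (fun n : ℕ ↦ (κ n : ℝ) * (ρ n - 1)) atTop (𝓝 0))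
    -- the data, as a triangular array
    (y : ℕ → ℕ → Ω → ℝ) (hy : ∀ n i ω, y n i ω = arPath (ρ n) (κ n) (fun k ↦ ε k ω) i)
    -- any choice of the estimator
    (ρLAD : ℕ → Ω → ℝ) (hρLAD_meas : ∀ n, AEMeasurable (ρLAD n) P)
    (hρLAD : ∀ n, 1 ≤ n → ∀ᵐ ω ∂P, IsLADEstimate n (fun i ↦ y n i ω) (ρLAD n ω)) :
    TendstoInDistribution
        (fun (n : ℕ) ω ↦ √((n : ℝ) * (κ n : ℝ)) * (ρLAD n ω - ρ n)) atTop
        (fun c : ℝ ↦ c / (2 * σ * f 0)) (fun _ ↦ P) (cauchyMeasure 0 1) ∧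
      TendstoInDistribution
        (fun (n : ℕ) ω ↦ √(∑ i ∈ Finset.Icc 1 n, y n (i - 1) ω ^ 2) * (ρLAD n ω - ρ n)) atTop
        (fun z : ℝ ↦ z) (fun _ ↦ P) (gaussianReal 0 (Real.toNNReal (1 / (4 * f 0 ^ 2)))) := by
  have hf_cont : Continuous f := hf_diff.continuous
  have hprob : IsProbabilityMeasure (volume.withDensity fun x ↦ ENNReal.ofReal (f x)) := by
    rw [← hf_density]; exact Measure.isProbabilityMeasure_map (hmeas 1).aemeasurable
  obtain ⟨C, hC0, hC'⟩ := exists_withDensity_Icc_le hf_cont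
  have hC : ∀ t, 0 ≤ t → P {ω | |ε 1 ω| ≤ t} ≤ ENNReal.ofReal (C * t) := fun t ht ↦ by
    refine le_trans (le_of_eq ?_) (hC' t ht)
    rw [← hf_density, Measure.map_apply (hmeas 1) measurableSet_Icc]
    congr 1; ext ω
    exact abs_le (a := ε 1 ω) (b := t)
  have hquad : ∀ η > 0, ∃ c > 0, ∀ a, |a| ≤ c →
      |∫ ω, absRem a (ε 1 ω) ∂P - f 0 * a ^ 2| ≤ η * a ^ 2 := fun η hη ↦ by
    obtain ⟨c, hc, h⟩ := exists_abs_integral_absRem_sub_le hf_nonneg hf_cont hη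
    refine ⟨c, hc, fun a ha ↦ ?_⟩
    have := h a ha
    rwa [← hf_density, integral_map (hmeas 1).aemeasurable
      (by unfold absRem; fun_prop : Measurable (absRem a)).aestronglyMeasurable] at this
  have hzero : P {ω | ε 1 ω = 0} = 0 := by
    have := hC 0 le_rfl
    simpa using this
  have hs := integral_signPos_eq_zero (hmeas 1) hzero hmedle hmedge
  have hεL2 (i : ℤ) : MemLp (ε i) 2 P := (hident i).memLp_iff.2 hL2
  have hε0 (i : ℤ) : ∫ ω, ε i ω ∂P = 0 := (hident i).integral_eq.trans hmean
  have hε2 (i : ℤ) : ∫ ω, ε i ω ^ 2 ∂P = σ ^ 2 := by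
    rw [← hvar, variance_of_integral_eq_zero (hmeas 1).aemeasurable hmean]
    exact ((hident i).comp (u := fun x ↦ x ^ 2) (by fun_prop)).integral_eq
  -- With `σ = 0` the noise would vanish almost surely, contradicting the absence of an atom at `0`.
  have hσ0 : 0 < σ := by
    refine hσ.lt_of_ne' fun h ↦ ?_
    have h1 := hε2 1
    rw [h, zero_pow two_ne_zero, integral_eq_zero_iff_of_nonneg (fun ω ↦ sq_nonneg _)
      hL2.integrable_sq] at h1
    have h2 : ∀ᵐ ω ∂P, ε 1 ω = 0 := h1.mono fun ω hω ↦ by simpa using hω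
    have h3 : ∀ᵐ ω ∂P, ¬ε 1 ω = 0 := by simpa [ae_iff] using hzero
    obtain ⟨ω, hω, hω'⟩ := (h2.and h3).exists
    exact hω' hω
  have hκ' : Tendsto κ atTop atTop := by
    rw [← tendsto_natCast_atTop_iff (R := ℝ)]
    refine tendsto_atTop_mono' _ ?_ hκ
    filter_upwards [eventually_ge_atTop 1] with n hn
    exact div_le_self (Nat.cast_nonneg _) (by exact_mod_cast hn)
  have hρ' : ∀ᶠ n in atTop, 1 ≤ ρ n := by
    filter_upwards [eventually_ge_atTop 1] with n hn using (hρ n hn).le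
  have hbound := tendsto_incrementBound hρ hnρ hκ hκ' hκρ σ
  have hy' (n : ℕ) (ω : Ω) : (fun i ↦ y n i ω) = arPath (ρ n) (κ n) fun k ↦ ε k ω :=
    funext fun i ↦ hy n i ω
  have hLAD : ∀ n, 1 ≤ n → ∀ᵐ ω ∂P,
      IsLADEstimate n (arPath (ρ n) (κ n) fun k ↦ ε k ω) (ρLAD n ω) := fun n hn ↦ by
    simpa only [hy'] using hρLAD n hn
  have hymeas (n i : ℕ) : Measurable fun ω ↦ arPath (ρ n) (κ n) (fun k ↦ ε k ω) i :=
    (measurable_arPath (ρ n) (κ n) i).mono (pastSigma_le hmeas _) le_rfl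
  -- the normalised initial value
  set V : ℕ → Ω → ℝ := fun n ω ↦ arPath (ρ n) (κ n) (fun k ↦ ε k ω) 0 / √(κ n) with hVdef
  set V' : ℕ → Ω → ℝ := fun n ω ↦ (√(κ n))⁻¹ * ∑ j ∈ Finset.range (κ n), ε (-(j : ℤ)) ω
  set θ : ℕ → Ω → ℝ := fun n ω ↦
    (2 * f 0)⁻¹ * ((√n)⁻¹ * ∑ i ∈ Finset.range n, signPos (ε ((i : ℤ) + 1) ω))
  set W : ℕ → Ω → ℝ := fun n ω ↦
    √n * arPath (ρ n) (κ n) (fun k ↦ ε k ω) 0 * (ρLAD n ω - ρ n) with hWdef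
  set N : ℕ → Ω → ℝ := fun n ω ↦ √((n : ℝ)⁻¹ * ∑ i ∈ Finset.range n,
    (arPath (ρ n) (κ n) (fun k ↦ ε k ω) i / √(κ n)) ^ 2) with hNdef
  have hVm (n : ℕ) : Measurable (V n) := (hymeas n 0).div_const _
  have hV'L2 (n : ℕ) : MemLp (V' n) 2 P := (memLp_finsetSum _ fun j _ ↦ hεL2 _).const_mul _
  have hVL2 (n : ℕ) : MemLp (V n) 2 P :=
    ((memLp_arPath hεL2 (ρ n) (κ n) 0).const_mul (√(κ n))⁻¹).ae_eq
      (Eventually.of_forall fun ω ↦ by simp only [V]; ring)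
  have hV'dist := tendstoInDistribution_inv_sqrt_mul_sum_neg hindep hident hεL2 hε0 hε2 hκ'
  have hVV' : TendstoInMeasure P (fun n ω ↦ V n ω - V' n ω) atTop 0 :=
    tendstoInMeasure_zero_of_integral_abs_tendsto
      (fun n ↦ ((hVL2 n).sub (hV'L2 n)).integrable one_le_two)
      (tendsto_integral_abs_arPath_zero_sub hindep hεL2 hε0 hε2 hρ' hκ' hκρ)
  have hVdist : TendstoInDistribution V atTop (fun v : ℝ ↦ σ * v) (fun _ ↦ P) (gaussianReal 0 1) :=
    tendstoInDistribution_of_tendstoInMeasure_sub V _ hV'dist hVV' fun n ↦ (hVm n).aemeasurable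
  have hγ0 : ∀ᵐ v ∂(gaussianReal 0 1), v ≠ 0 := by
    have := nullSingletonClass_gaussianReal (μ := 0) (one_ne_zero (α := NNReal))
    exact compl_mem_ae_iff.2 (measure_singleton (0 : ℝ))
  have hVsmall : ∀ τ : ENNReal, 0 < τ → ∃ δ : ℝ, 0 < δ ∧ ∀ᶠ n in atTop,
      P {ω | |V n ω| < δ} < τ := fun τ hτ ↦ by
    obtain ⟨m, hm⟩ := exists_eventually_measure_preimage_lt hVdist
      (C := fun m : ℕ ↦ {x | |x| ≤ 1 / ((m : ℝ) + 1)})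
      (fun i j hij x (hx : |x| ≤ _) ↦ hx.trans (by gcongr)) (fun m ↦
        isClosed_le continuous_abs continuous_const) (hγ0.mono fun v hv ↦ by
          obtain ⟨m, hm⟩ := exists_nat_one_div_lt (abs_pos.2 (mul_ne_zero hσ0.ne' hv))
          exact ⟨m, fun h ↦ absurd hm (not_lt.2 h)⟩) hτ
    refine ⟨1 / ((m : ℝ) + 1), by positivity, hm.mono fun n hn ↦ lt_of_le_of_lt ?_ hn⟩
    exact measure_mono fun ω (hω : |V n ω| < _) ↦ hω.le
  have hWθ : TendstoInMeasure P (fun n ω ↦ W n ω - θ n ω) atTop 0 :=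
    tendstoInMeasure_lad_sub hmeas hindep hident hεL2 hε0 hε2 hs hC0.le hC hf_zero hquad hρ hbound
      hVsmall hLAD
  have hNV : TendstoInMeasure P (fun n ω ↦ N n ω - |V n ω|) atTop 0 := by
    obtain ⟨h1, h2⟩ := tendsto_integral_abs_sqrt_mean_sub hindep hεL2 hε0 hε2 hρ hbound
    exact tendstoInMeasure_zero_of_integral_abs_tendsto h1 h2
  -- joint convergence
  have hθdist : TendstoInDistribution θ atTop (fun z : ℝ ↦ (2 * f 0)⁻¹ * z) (fun _ ↦ P)
      (gaussianReal 0 1) :=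
    (tendstoInDistribution_inv_sqrt_mul_sum_signPos hindep hident hs).continuous_comp
      (g := fun x ↦ (2 * f 0)⁻¹ * x) (by fun_prop)
  have hindepVθ (n : ℕ) : IndepFun (V' n) (θ n) P := by
    have := indepFun_sum_nonpos_sum_pos hmeas hindep (κ n) n (√(κ n))⁻¹ ((2 * f 0)⁻¹ * (√n)⁻¹)
    simpa only [mul_assoc] using this
  -- The third coordinate `|V'|` is carried along so that `N`, which is asymptotic to it, converges
  -- jointly with `V` and `W`.
  have hjoint := (tendstoInDistribution_prodMk_of_indepFun hV'dist hθdist (by fun_prop)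
    (by fun_prop) hindepVθ).continuous_comp (g := fun p : ℝ × ℝ ↦ (p.1, p.2, |p.1|)) (by fun_prop)
  have hNV' : TendstoInMeasure P (fun n ω ↦ N n ω - |V' n ω|) atTop 0 :=
    tendstoInMeasure_zero_of_abs_le_add hNV hVV' fun n ω ↦
      (abs_sub_le _ |V n ω| _).trans (add_le_add_right (abs_abs_sub_abs_le_abs_sub _ _) _)
  have hWm (n : ℕ) : AEMeasurable (W n) P :=
    ((hymeas n 0).aemeasurable.const_mul _).mul ((hρLAD_meas n).sub_const _)
  have hNm (n : ℕ) : Measurable (N n) :=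
    ((Finset.measurable_sum _ fun i _ ↦ ((hymeas n i).div_const _).pow_const 2).const_mul _).sqrt
  have hB : TendstoInDistribution (fun n ω ↦ (V n ω, W n ω, N n ω)) atTop
      (fun p : ℝ × ℝ ↦ (σ * p.1, (2 * f 0)⁻¹ * p.2, |σ * p.1|)) (fun _ ↦ P)
      ((gaussianReal 0 1).prod (gaussianReal 0 1)) :=
    tendstoInDistribution_of_tendstoInMeasure_sub _ _ hjoint
      (tendstoInMeasure_prodMk_zero hVV' (tendstoInMeasure_prodMk_zero hWθ hNV'))
      fun n ↦ (hVm n).aemeasurable.prodMk ((hWm n).prodMk (hNm n).aemeasurable)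
  have hZ : ∀ᵐ p ∂((gaussianReal 0 1).prod (gaussianReal 0 1)),
      (σ * (p : ℝ × ℝ).1, (2 * f 0)⁻¹ * p.2, |σ * p.1|).1 ≠ 0 := by
    have : ∀ᵐ p ∂((gaussianReal 0 1).prod (gaussianReal 0 1)), (p : ℝ × ℝ).1 ≠ 0 :=
      Measure.quasiMeasurePreserving_fst.ae hγ0
    exact this.mono fun p hp ↦ mul_ne_zero hσ0.ne' hp
  -- `y 0` cancels: both statistics become functions of `(V, W, N)`, namely `W / V` and `N * (W /
  -- V)`, wherever `V ≠ 0`.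
  have hratio {n : ℕ} {ω : Ω} (hV : V n ω ≠ 0) :
      W n ω / V n ω = √n * √(κ n) * (ρLAD n ω - ρ n) := by
    have h1 : arPath (ρ n) (κ n) (fun k ↦ ε k ω) 0 ≠ 0 := fun h ↦ hV (by
      simp only [hVdef]; rw [h, zero_div])
    have h2 : √(κ n : ℝ) ≠ 0 := fun h ↦ hV (by simp only [hVdef]; rw [h, div_zero])
    simp only [hVdef, hWdef]
    field_simp
  constructor
  · have hlim := tendstoInDistribution_of_eq_off_zero hB hZ (g := fun p ↦ p.2.1 / p.1)
      (by fun_prop) (fun p hp ↦ by fun_prop (disch := assumption))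
      (Y := fun (n : ℕ) ω ↦ √((n : ℝ) * (κ n : ℝ)) * (ρLAD n ω - ρ n))
      (fun n ↦ ((hρLAD_meas n).sub_const _).const_mul _)
      (Eventually.of_forall fun n ω hω ↦ by
        rw [hratio hω, Real.sqrt_mul (Nat.cast_nonneg n)])
    refine tendstoInDistribution_of_map_limit_eq hlim (by fun_prop) ?_
    have hfun : (fun p : ℝ × ℝ ↦ (2 * f 0)⁻¹ * p.2 / (σ * p.1)) =
        (fun c : ℝ ↦ c / (2 * σ * f 0)) ∘ fun p : ℝ × ℝ ↦ p.2 / p.1 := by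
      ext p
      simp only [Function.comp_apply, div_eq_mul_inv, mul_inv]
      ring
    simp only
    rw [hfun, ← Measure.map_map (by fun_prop) (by fun_prop), map_div_gaussianReal_prod]
  · have hlim := tendstoInDistribution_of_eq_off_zero hB hZ (g := fun p ↦ p.2.2 * (p.2.1 / p.1))
      (by fun_prop) (fun p hp ↦ by fun_prop (disch := assumption))
      (Y := fun (n : ℕ) ω ↦ √(∑ i ∈ Finset.Icc 1 n, y n (i - 1) ω ^ 2) * (ρLAD n ω - ρ n))
      (fun n ↦ by
        simp_rw [hy]
        exact (Finset.measurable_sum _ fun i _ ↦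
          (hymeas n _).pow_const 2).sqrt.aemeasurable.mul ((hρLAD_meas n).sub_const _)) (by
        filter_upwards [eventually_ge_atTop 1] with n hn ω hω
        have hn0 : (0 : ℝ) < n := by exact_mod_cast hn
        have h2 : √(κ n : ℝ) ≠ 0 := fun h ↦ hω (by simp only [hVdef]; rw [h, div_zero])
        rw [hratio hω, sum_Icc_one_eq_sum_range]
        have h3 : N n ω = √(∑ i ∈ Finset.range n,
            arPath (ρ n) (κ n) (fun k ↦ ε k ω) i ^ 2) / (√n * √(κ n)) := by
          simp only [hNdef, div_pow]
          rw [← Finset.sum_div, Real.sq_sqrt (Nat.cast_nonneg _), ← Real.sqrt_mul hn0.le,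
            ← Real.sqrt_div' _ (by positivity)]
          congr 1
          field_simp
        simp only [Nat.add_sub_cancel, hy, h3]
        field_simp)
    refine tendstoInDistribution_of_map_limit_eq hlim (by fun_prop) ?_
    -- The scale `σ` cancels, so only the random sign of `p.1` multiplies the Gaussian `(2 * f 0)⁻¹
    -- * p.2`.
    have hfun : (fun p : ℝ × ℝ ↦ |σ * p.1| * ((2 * f 0)⁻¹ * p.2 / (σ * p.1))) =
        (fun p : ℝ × ℝ ↦ |p.1| * p.2 / p.1) ∘ Prod.map id fun z ↦ (2 * f 0)⁻¹ * z := by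
      ext p
      simp only [Function.comp_apply, Prod.map, id]
      rw [abs_mul, abs_of_pos hσ0]
      field_simp
    simp only
    rw [hfun, ← Measure.map_map (by fun_prop) (by fun_prop), ← Measure.map_prod_map _ _
      (by fun_prop) (by fun_prop), Measure.map_id, gaussianReal_map_const_mul, mul_zero,
      map_sign_mul_gaussianReal_prod, Measure.map_id']
    congr 1
    ext
    rw [Real.coe_toNNReal _ (by positivity)]
    simp
    ring
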